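/- A noncommutative arithmetic circuit over a field $\mathbb F$ in variables $x_1,\dots,x_n$ is a finite directed acyclic graph whose input nodes are labelled by variables or constants and whose other nodes are $+$ gates (computing $\mathbb F$-linear combinations of their inputs) or $\times$ gates (computing ordered products); its size is the number of nodes plus the number of wires. It is a *homogeneous $\Sigma\Pi^*\Sigma$ circuit* if its output is a $\Sigma$ gate, all inputs of the output gate are $\Pi$ gates of the same syntactic degree, and every input-to-output path goes through a bottom $\Sigma$ gate (computing a homogeneous linear form $\sum_i\alpha_i x_i$), then through one or more $\Pi$ gates, and ends at the output gate. **Corollary.** There is a randomized algorithm with the following property. Let $\mathbb F$ be any field and let $C$ be a homogeneous $\Sigma\Pi^*\Sigma$ circuit over $\mathbb F$ of size at most $s$, computing a polynomial $f\in\mathbb F\langle x_1,\dots,x_n\rangle$. Given $n$, $s$ and black-box access to $C$ (that is, for any dimension $d$ and any $d\times d$ matrices $M_1,\dots,M_n$ over $\mathbb F$ the algorithm may ask for the value of $C$ at $(M_1,\dots,M_n)$), the algorithm runs in time $\mathrm{poly}(s,n)$ and checks whether $f$ is identically zero: if $f=0$ it always answers "identically zero", and if $f\neq0$ it answers "not identically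 zero" with probability at least $2/3$. Here the algorithm is one program, and $\mathrm{poly}$ one polynomial, for all $\mathbb F,n,s,C$. Operations on field elements (arithmetic and zero tests), additions, subtractions and zero tests of natural numbers, and fair random bits cost one time unit each, and a query in dimension $d$ costs $1+(n+1)d^2$; the time bound holds for every outcome of the random bits. -/

import Mathlib

universe u v

/-- The `i`-th node of a noncommutative arithmetic circuit over `F` in `n` variables.  The nodes
are listed in a topological order, so the inputs of node `i` are nodes `j < i`.
A `+` node computes a linear combination of its inputs (the coefficients label the wires), a `×`
node the product of its inputs from left to right; fan-in is unbounded. -/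
inductive NCGate (F : Type u) (n i : ℕ) : Type u
  | var (k : Fin n)
  | const (c : F)
  | sum (l : List (F × Fin i))
  | prod (l : List (Fin i))

/-- The number of wires entering a node. -/
def NCGate.fanIn {F : Type u} {n i : ℕ} : NCGate F n i → ℕ
  | .var _ => 0
  | .const _ => 0
  | .sum l => l.length
  | .prod l => l.length

/-- A noncommutative arithmetic circuit: a finite directed acyclic graph with an output node. -/
structure NCCircuit (F : Type u) (n : ℕ) where
  numGates : ℕ
  gate : (i : Fin numGates) → NCGate F n i
  out : Fin numGates

namespace NCCircuit

variable {F : Type u} {n : ℕ}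

/-- An input `j < i` of node `i`, as a node of the circuit. -/
def input (C : NCCircuit F n) (i : Fin C.numGates) (j : Fin (i : ℕ)) : Fin C.numGates :=
  ⟨j, j.2.trans i.2⟩

/-- The size: number of nodes plus number of wires. -/
def size (C : NCCircuit F n) : ℕ :=
  ∑ i : Fin C.numGates, (1 + (C.gate i).fanIn)

/-- The value of node `i` when the variables are given values `x` in an `F`-algebra `A`. -/
def nodeVal [Field F] {A : Type v} [Ring A] [Algebra F A] (C : NCCircuit F n) (x : Fin n → A)
    (i : Fin C.numGates) : A :=
  match C.gate i with
  | .var k => x k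
  | .const c => algebraMap F A c
  | .sum l => (l.map fun e => e.1 • C.nodeVal x (C.input i e.2)).sum
  | .prod l => (l.map fun j => C.nodeVal x (C.input i j)).prod
termination_by i.val
decreasing_by
  · exact e.2.2
  · exact j.2

/-- The value of the circuit at `x`. -/
def eval [Field F] {A : Type v} [Ring A] [Algebra F A] (C : NCCircuit F n) (x : Fin n → A) : A :=
  C.nodeVal x C.out

/-- The noncommutative polynomial in `F⟨x₁, …, xₙ⟩` computed by the circuit. -/
def poly [Field F] (C : NCCircuit F n) : FreeAlgebra F (Fin n) :=
  C.eval (FreeAlgebra.ι F)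

/-- Black-box access: evaluation of the circuit on `d × d` matrices over `F`. -/
def blackBox [Field F] (C : NCCircuit F n) (d : ℕ) (M : Fin n → Matrix (Fin d) (Fin d) F) :
    Matrix (Fin d) (Fin d) F :=
  C.eval M

/-- The syntactic degree of a node. -/
def syntDegree (C : NCCircuit F n) (i : Fin C.numGates) : ℕ :=
  match C.gate i with
  | .var _ => 1
  | .const _ => 0
  | .sum l => (l.map fun e => C.syntDegree (C.input i e.2)).foldr max 0
  | .prod l => (l.map fun j => C.syntDegree (C.input i j)).sum
termination_by i.val
decreasing_by
  · exact e.2.2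
  · exact j.2

/-- A bottom `Σ` gate: a `+` node all of whose inputs are variables, so that it computes a
homogeneous linear form. -/
def IsLinearForm (C : NCCircuit F n) (i : Fin C.numGates) : Prop :=
  ∃ l : List (F × Fin (i : ℕ)), C.gate i = .sum l ∧ l ≠ [] ∧
    ∀ e ∈ l, ∃ k : Fin n, C.gate (C.input i e.2) = .var k

/-- A `Π` gate such that every path from an input node to it passes through a bottom `Σ` gate and
then only through one or more `×` gates. -/
def IsPiGate (C : NCCircuit F n) (i : Fin C.numGates) : Prop :=
  match C.gate i with
  | .prod l => l ≠ [] ∧ ∀ j ∈ l, C.IsLinearForm (C.input i j) ∨ C.IsPiGate (C.input i j)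
  | _ => False
termination_by i.val
decreasing_by exact j.2

/-- Homogeneous `ΣΠ*Σ` circuits: the output is a `Σ` gate, its inputs are `Π` gates of one and the
same syntactic degree, and every input-to-output path consists of a bottom `Σ` gate, one or more
`Π` gates, and the output gate. -/
def IsHomogeneousSigmaPiStarSigma (C : NCCircuit F n) : Prop :=
  ∃ l : List (F × Fin (C.out : ℕ)), C.gate C.out = .sum l ∧
    (∀ e ∈ l, C.IsPiGate (C.input C.out e.2)) ∧
    ∃ D : ℕ, ∀ e ∈ l, C.syntDegree (C.input C.out e.2) = D

end NCCircuit

/-- Programs of a randomized random-access machine with black-box access.  The machine has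
registers holding natural numbers and a memory of field elements.  Below `[a]` is the memory cell
whose address is the content of register `a`.  A program is finite, and mentions neither the field
nor the number of variables. -/
inductive BBProg : Type
  /-- `a := 0` -/
  | zero (a : ℕ)
  /-- `a := b + 1` -/
  | succ (a b : ℕ)
  /-- `a := b + c` -/
  | add (a b c : ℕ)
  /-- `a := max (b - c) 0` -/
  | sub (a b c : ℕ)
  /-- `[a] := 0` -/
  | fzero (a : ℕ)
  /-- `[a] := 1` -/
  | fone (a : ℕ)
  /-- `[a] := [b]` -/
  | fcopy (a b : ℕ)
  /-- `[a] := [b] + [c]` -/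
  | fadd (a b c : ℕ)
  /-- `[a] := [b] - [c]` -/
  | fsub (a b c : ℕ)
  /-- `[a] := [b] * [c]` -/
  | fmul (a b c : ℕ)
  /-- `[a] := [b]⁻¹`, with `0⁻¹ = 0` -/
  | finv (a b : ℕ)
  /-- `a :=` a fresh fair random bit -/
  | flip (a : ℕ)
  /-- Query the black box.  With `d` the content of register `a`, the `n` square matrices of
  dimension `d` stored one after another (row by row) from `[b]` on are submitted, and the matrix
  returned is stored (row by row) from `[c]` on. -/
  | query (a b c : ℕ)
  /-- first `p`, then `q` -/
  | seq (p q : BBProg)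
  /-- if `a = 0` then `p` else `q` -/
  | ifZero (a : ℕ) (p q : BBProg)
  /-- if `[a] = 0` then `p` else `q` -/
  | ifFZero (a : ℕ) (p q : BBProg)
  /-- repeat `p`, as many times as register `a` says when the loop is entered -/
  | loop (a : ℕ) (p : BBProg)

/-- A configuration of the machine: registers, memory, number of random bits used so far, and time
elapsed so far. -/
structure BBState (F : Type u) where
  reg : ℕ → ℕ
  mem : ℕ → F
  coins : ℕ
  time : ℕ

namespace BBState

variable {F : Type u}

/-- Let `t` time units pass. -/
def tick (σ : BBState F) (t : ℕ) : BBState F := { σ with time := σ.time + t }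

/-- `a := x`, in one time unit. -/
def setReg (σ : BBState F) (a x : ℕ) : BBState F :=
  { σ with reg := Function.update σ.reg a x, time := σ.time + 1 }

/-- `[a] := x`, in one time unit. -/
def setMem (σ : BBState F) (a : ℕ) (x : F) : BBState F :=
  { σ with mem := Function.update σ.mem (σ.reg a) x, time := σ.time + 1 }

/-- The content of `[a]`. -/
def get (σ : BBState F) (a : ℕ) : F := σ.mem (σ.reg a)

/-- The `n` matrices of dimension `d` stored row by row from address `b` on. -/
def readMatrices (σ : BBState F) (n d b : ℕ) : Fin n → Matrix (Fin d) (Fin d) F :=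
  fun k => Matrix.of fun i j => σ.mem (b + (((k : ℕ) * d + i) * d + j))

/-- Store the matrix `M` row by row from address `b` on. -/
def writeMatrix (σ : BBState F) (d b : ℕ) (M : Matrix (Fin d) (Fin d) F) : BBState F :=
  { σ with
    mem := fun x =>
      if h : b ≤ x ∧ x - b < d * d then
        M ⟨(x - b) / d, Nat.div_lt_of_lt_mul h.2⟩
          ⟨(x - b) % d, Nat.mod_lt _ (Nat.pos_of_mul_pos_left (Nat.zero_lt_of_lt h.2))⟩
      else σ.mem x }

/-- The initial configuration: `n` and `s` are in the registers `0` and `1`, all else is `0`. -/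
def init (F : Type u) [Field F] (n s : ℕ) : BBState F where
  reg := fun a => if a = 0 then n else if a = 1 then s else 0
  mem := fun _ => 0
  coins := 0
  time := 0

/-- The answer is read off register `2`: it is "identically zero" if the content is `0`, and
"not identically zero" otherwise. -/
def AnswersZero (σ : BBState F) : Prop := σ.reg 2 = 0

end BBState

open Classical in
/-- Running a program on the black box `B` with the random bits `ω 0, ω 1, …`.  Operations on
registers and on field elements, tests and random bits cost one time unit each, so does each
iteration of a loop besides what its body costs, and a query in dimension `d` costs
`1 + (n + 1) * d ^ 2`, the number of matrix entries submitted and returned plus one. -/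
noncomputable def BBProg.run {F : Type u} [Field F] {n : ℕ}
    (B : (d : ℕ) → (Fin n → Matrix (Fin d) (Fin d) F) → Matrix (Fin d) (Fin d) F)
    (ω : ℕ → Bool) : BBProg → BBState F → BBState F
  | .zero a, σ => σ.setReg a 0
  | .succ a b, σ => σ.setReg a (σ.reg b + 1)
  | .add a b c, σ => σ.setReg a (σ.reg b + σ.reg c)
  | .sub a b c, σ => σ.setReg a (σ.reg b - σ.reg c)
  | .fzero a, σ => σ.setMem a 0
  | .fone a, σ => σ.setMem a 1
  | .fcopy a b, σ => σ.setMem a (σ.get b)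
  | .fadd a b c, σ => σ.setMem a (σ.get b + σ.get c)
  | .fsub a b c, σ => σ.setMem a (σ.get b - σ.get c)
  | .fmul a b c, σ => σ.setMem a (σ.get b * σ.get c)
  | .finv a b, σ => σ.setMem a (σ.get b)⁻¹
  | .flip a, σ => { σ.setReg a (if ω σ.coins then 1 else 0) with coins := σ.coins + 1 }
  | .query a b c, σ =>
      (σ.writeMatrix (σ.reg a) (σ.reg c)
        (B (σ.reg a) (σ.readMatrices n (σ.reg a) (σ.reg b)))).tick
          (1 + (n + 1) * σ.reg a ^ 2)
  | .seq p q, σ => q.run B ω (p.run B ω σ)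
  | .ifZero a p q, σ => if σ.reg a = 0 then p.run B ω (σ.tick 1) else q.run B ω (σ.tick 1)
  | .ifFZero a p q, σ => if σ.get a = 0 then p.run B ω (σ.tick 1) else q.run B ω (σ.tick 1)
  | .loop a p, σ => (fun τ => p.run B ω (τ.tick 1))^[σ.reg a] (σ.tick 1)

open Classical in
/-- The probability of `E` for `T` independent fair random bits (followed by `false`s, which a
program that runs in time at most `T` never reads). -/
noncomputable def coinProb (T : ℕ) (E : (ℕ → Bool) → Prop) : ℚ :=
  ((Finset.univ.filter fun ω : Fin T → Bool =>
      E fun i => if h : i < T then ω ⟨i, h⟩ else false).card : ℚ) / 2 ^ T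

/-! A homogeneous ΣΠ*Σ circuit of size at most s computes a sum `f` of at most s ordered products,
all of D linear forms, with D ≤ 2^s. If `f` is nonzero, it does not vanish on generic matrices whose
dimension N is at least the number of products (`formSum_generic_ne_zero`). The proof is by
induction on D. If all first factors are multiples of one form w, then w splits off on the left, and
its value at generic matrices has nonzero determinant. Otherwise some functional φ kills one first
factor, while evaluating all first factors at φ leaves a nonzero sum (`exists_functional`). This sum
has one product less, and it appears as entries of `f` at matrices bordered by one extra row and
column.

So some entry of `f` at generic matrices is a nonzero commutative polynomial of degree at most 2^s.
Schwartz–Zippel needs a sample spread over exponentially many points, and F may be too small.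
Therefore draw a monic modulus h of degree N and, for every matrix entry, a polynomial g of degree
less than N, all with random 2N-bit coefficients mapped into F; replace each entry by the N × N
matrix of multiplication by g modulo h. Over the algebraic closure a root θ of h gives all blocks a
common eigenvector with eigenvalues g(θ), so if `f` vanishes at the N²-dimensional matrices, it
vanishes at the N-dimensional ones with entries g(θ) (`formSum_eigen_eq_zero`).

The value g(θ) hits any given point with probability at most 2^(-N): in characteristic 0 or at least
2^N because of the constant term alone, in smaller characteristic p whenever h is irreducible modulo
p, which has probability at least 1/(4N) (`exists_good_moduli`). The program needs to know neither p
nor θ nor whether h is irreducible; they occur in the analysis only.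

One round thus detects `f ≠ 0` with probability at least 1/(8N) (`card_roundDetects`) and never errs
on `f = 0`. With N = s + 16, N² independent rounds push the error below 1/3. The rest is the
verification of the program by loop invariants, with exact running times. -/

/-! ### Sums of products of linear forms at generic matrices. -/

section LinearForms

variable {F : Type u} [Field F] {n : ℕ}

/-- The linear form with coefficients `v`, evaluated at `x`. -/
def linForm {A : Type v} [Ring A] [Algebra F A] (v : Fin n → F) (x : Fin n → A) : A :=
  ∑ k, v k • x k

/-- The ordered product of a list of linear forms, evaluated at `x`. -/
def formProd {A : Type v} [Ring A] [Algebra F A] (l : List (Fin n → F)) (x : Fin n → A) : A :=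
  (l.map fun v => linForm v x).prod

/-- A linear combination of products of linear forms, evaluated at `x`. -/
def formSum {A : Type v} [Ring A] [Algebra F A] {ι : Type*} (S : Finset ι) (c : ι → F)
    (L : ι → List (Fin n → F)) (x : Fin n → A) : A :=
  ∑ i ∈ S, c i • formProd (L i) x

/-- The `n` generic matrices of dimension `N`. -/
noncomputable def genericMatrices (F : Type u) [Field F] (n N : ℕ) :
    Fin n → Matrix (Fin N) (Fin N) (MvPolynomial (Fin n × Fin N × Fin N) F) :=
  fun k => Matrix.of fun a b => MvPolynomial.X (k, a, b)

theorem map_linForm {A B : Type*} [Ring A] [Algebra F A] [Ring B] [Algebra F B] (f : A →ₐ[F] B)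
    (v : Fin n → F) (x : Fin n → A) : f (linForm v x) = linForm v fun k => f (x k) := by
  simp [linForm]

theorem map_formProd {A B : Type*} [Ring A] [Algebra F A] [Ring B] [Algebra F B] (f : A →ₐ[F] B)
    (l : List (Fin n → F)) (x : Fin n → A) : f (formProd l x) = formProd l fun k => f (x k) := by
  simp [formProd, map_list_prod, Function.comp_def, map_linForm]

theorem map_formSum {A B : Type*} [Ring A] [Algebra F A] [Ring B] [Algebra F B] (f : A →ₐ[F] B)
    {ι : Type*} (S : Finset ι) (c : ι → F) (L : ι → List (Fin n → F)) (x : Fin n → A) :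
    f (formSum S c L x) = formSum S c L fun k => f (x k) := by
  simp [formSum, map_formProd]

/-- Matrices over a commutative algebra are specializations of the generic ones. -/
theorem formSum_matrix_eq_map {R : Type*} [CommRing R] [Algebra F R] {N : ℕ} {ι : Type*}
    (S : Finset ι) (c : ι → F) (L : ι → List (Fin n → F))
    (M : Fin n → Matrix (Fin N) (Fin N) R) :
    formSum S c L M = (formSum S c L (genericMatrices F n N)).map
      (MvPolynomial.aeval fun z : Fin n × Fin N × Fin N => M z.1 z.2.1 z.2.2) := by
  rw [← AlgHom.mapMatrix_apply, map_formSum]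
  congr 1
  ext k a b
  simp [genericMatrices]

theorem linForm_smul {A : Type v} [Ring A] [Algebra F A] (r : F) (v : Fin n → F) (x : Fin n → A) :
    linForm (r • v) x = r • linForm v x := by
  simp [linForm, Finset.smul_sum, mul_smul]

theorem linForm_apply {R : Type*} [CommRing R] [Algebra F R] {N : ℕ} (v : Fin n → F)
    (M : Fin n → Matrix (Fin N) (Fin N) R) (a b : Fin N) :
    linForm v M a b = ∑ k, v k • M k a b := by
  simp [linForm, Matrix.sum_apply]

/-- Choose k with v k ≠ 0 and specialize the k-th matrix to the identity, the others to zero: the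
determinant becomes (v k)^N. -/
theorem det_linForm_generic_ne_zero {N : ℕ} {v : Fin n → F} (hv : v ≠ 0) :
    (linForm v (genericMatrices F n N)).det ≠ 0 := by
  obtain ⟨k, hk⟩ := Function.ne_iff.1 hv
  intro h
  let φ : MvPolynomial (Fin n × Fin N × Fin N) F →ₐ[F] F :=
    MvPolynomial.aeval fun z => if z.1 = k then (1 : Matrix (Fin N) (Fin N) F) z.2.1 z.2.2 else 0
  have h1 : φ.mapMatrix (linForm v (genericMatrices F n N)) = v k • 1 := by
    rw [map_linForm]
    ext a b
    rw [linForm_apply]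
    simp [genericMatrices, φ]
  have h2 := congrArg φ h
  rw [AlgHom.map_det, h1, map_zero, Matrix.det_smul] at h2
  simp at h2
  exact hk h2.1

theorem formSum_cons_smul {A : Type v} [Ring A] [Algebra F A] {ι : Type*} (S : Finset ι)
    (c r : ι → F) (w : Fin n → F) (T L : ι → List (Fin n → F)) (x : Fin n → A)
    (h : ∀ i ∈ S, L i = (r i • w) :: T i) :
    formSum S c L x = linForm w x * formSum S (fun i => c i * r i) T x := by
  rw [formSum, formSum, Finset.mul_sum]
  refine Finset.sum_congr rfl fun i hi => ?_
  simp [h i hi, formProd, linForm_smul, mul_smul]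

/-- The matrices `[[0, φ k • e_p], [0, M k]]`. -/
def borderMatrices {R : Type*} [CommRing R] [Algebra F R] {N : ℕ} (φ : Fin n → F) (p : Fin N)
    (M : Fin n → Matrix (Fin N) (Fin N) R) :
    Fin n → Matrix (Fin (N + 1)) (Fin (N + 1)) R :=
  fun k => Matrix.of fun a b => Fin.cases 0
    (fun b' => Fin.cases (if b' = p then algebraMap F R (φ k) else 0) (fun a' => M k a' b') a) b

section border

variable {R : Type*} [CommRing R] [Algebra F R] {N : ℕ} (φ : Fin n → F) (p : Fin N)
    (M : Fin n → Matrix (Fin N) (Fin N) R)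

theorem linForm_border_succ_zero (v : Fin n → F) (a : Fin N) :
    linForm v (borderMatrices φ p M) a.succ 0 = 0 := by
  simp [linForm_apply, borderMatrices]

theorem linForm_border_zero_zero (v : Fin n → F) :
    linForm v (borderMatrices φ p M) 0 0 = 0 := by
  simp [linForm_apply, borderMatrices]

theorem linForm_border_succ_succ (v : Fin n → F) (a b : Fin N) :
    linForm v (borderMatrices φ p M) a.succ b.succ = linForm v M a b := by
  simp [linForm_apply, borderMatrices]

theorem linForm_border_zero_succ (v : Fin n → F) (b : Fin N) :
    linForm v (borderMatrices φ p M) 0 b.succ =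
      if b = p then algebraMap F R (v ⬝ᵥ φ) else 0 := by
  simp only [linForm_apply, borderMatrices, Matrix.of_apply, Fin.cases_zero, Fin.cases_succ]
  split_ifs with h
  · simp [dotProduct, Algebra.smul_def]
  · simp

theorem formProd_border_succ_succ (l : List (Fin n → F)) (a b : Fin N) :
    formProd l (borderMatrices φ p M) a.succ b.succ = formProd l M a b := by
  induction l generalizing a with
  | nil => simp [formProd, Matrix.one_apply]
  | cons v l ih =>
    simp only [formProd, List.map_cons, List.prod_cons] at ih ⊢
    rw [Matrix.mul_apply, Matrix.mul_apply, Fin.sum_univ_succ, linForm_border_succ_zero]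
    simp [linForm_border_succ_succ, ih]

/-- The only possibly nonzero entry in the top row of the first factor is in column p + 1, and it is
the value of the form at φ. From there on the lower right blocks multiply as they do without the
border. So the border contracts the first factor with φ. -/
theorem formProd_border_zero_succ (v : Fin n → F) (l : List (Fin n → F)) (b : Fin N) :
    formProd (v :: l) (borderMatrices φ p M) 0 b.succ = (v ⬝ᵥ φ) • formProd l M p b := by
  have h := fun c => formProd_border_succ_succ φ p M l c b
  simp only [formProd, List.map_cons, List.prod_cons] at h ⊢
  rw [Matrix.mul_apply, Fin.sum_univ_succ, linForm_border_zero_zero]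
  simp [linForm_border_zero_succ, h, Algebra.smul_def]

theorem formSum_border_zero_succ {ι : Type*} (S : Finset ι) (c : ι → F) (v : ι → Fin n → F)
    (T L : ι → List (Fin n → F)) (h : ∀ i ∈ S, L i = v i :: T i) (b : Fin N) :
    formSum S c L (borderMatrices φ p M) 0 b.succ =
      formSum S (fun i => c i * (v i ⬝ᵥ φ)) T M p b := by
  simp only [formSum, Matrix.sum_apply, Matrix.smul_apply]
  refine Finset.sum_congr rfl fun i hi => ?_
  rw [h i hi, formProd_border_zero_succ, mul_smul]

end border

/-- If not all `v i` are multiples of one vector, a nonzero noncommutative `∑ c i • v i * T i`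
stays nonzero after the first factors are replaced by their values under a functional that
vanishes at some `v i`. -/
theorem exists_functional {A : Type v} [Ring A] [Algebra F A] {ι : Type*} (S : Finset ι)
    (c : ι → F) (v : ι → Fin n → F) (T L : ι → List (Fin n → F)) (x : Fin n → A)
    (h : ∀ i ∈ S, L i = v i :: T i) (h0 : formSum S c L x ≠ 0) {i j : ι} (hi : i ∈ S) (hj : j ∈ S)
    (hij : v j ∉ Submodule.span F {v i}) :
    ∃ (φ : Fin n → F), (∃ k ∈ S, v k ⬝ᵥ φ = 0) ∧
      formSum S (fun i => c i * (v i ⬝ᵥ φ)) T x ≠ 0 := by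
  -- A coordinate functional does: the whole sum is the combination of its coordinate contractions
  -- with left coefficients x k.
  have h1 : ∃ φ : Fin n → F, formSum S (fun i => c i * (v i ⬝ᵥ φ)) T x ≠ 0 := by
    by_contra! h2
    apply h0
    have : formSum S c L x =
        ∑ k, x k * formSum S (fun i => c i * (v i ⬝ᵥ Pi.single k 1)) T x := by
      simp only [formSum, Finset.mul_sum]
      rw [Finset.sum_comm]
      refine Finset.sum_congr rfl fun i hi => ?_
      rw [h i hi]
      simp [formProd, linForm, Finset.sum_mul, Finset.smul_sum, mul_smul]
    rw [this]
    exact Finset.sum_eq_zero fun k _ => by rw [h2, mul_zero]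
  obtain ⟨φ, hφ⟩ := h1
  obtain ⟨χ, hχ⟩ : ∃ χ : Fin n → F, v i ⬝ᵥ χ = 0 ∧ v j ⬝ᵥ χ = 1 := by
    obtain ⟨f, hf, hf'⟩ := Submodule.exists_le_ker_of_notMem hij
    have hd : ∀ w : Fin n → F, w ⬝ᵥ (fun k => (f (v j))⁻¹ * f (Pi.single k 1)) =
        (f (v j))⁻¹ * f w := by
      intro w
      conv_rhs => rw [pi_eq_sum_univ' w]
      simp [dotProduct, Finset.mul_sum, mul_left_comm]
    refine ⟨_, (hd _).trans ?_, (hd _).trans (inv_mul_cancel₀ hf)⟩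
    have : f (v i) = 0 := hf' (Submodule.mem_span_singleton_self _)
    simp [this]
  -- If contraction with χ gives zero, a multiple of χ can be subtracted from φ to kill v j without
  -- changing the contracted sum. Otherwise χ itself works and kills v i.
  by_cases hc : formSum S (fun i => c i * (v i ⬝ᵥ χ)) T x = 0
  · refine ⟨φ - (v j ⬝ᵥ φ) • χ, ⟨j, hj, by simp [hχ.2]⟩, ?_⟩
    have : formSum S (fun i => c i * (v i ⬝ᵥ (φ - (v j ⬝ᵥ φ) • χ))) T x =
        formSum S (fun i => c i * (v i ⬝ᵥ φ)) T x -
          (v j ⬝ᵥ φ) • formSum S (fun i => c i * (v i ⬝ᵥ χ)) T x := by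
      simp only [formSum, Finset.smul_sum, ← Finset.sum_sub_distrib]
      refine Finset.sum_congr rfl fun i _ => ?_
      rw [smul_smul, ← sub_smul, dotProduct_sub, dotProduct_smul, smul_eq_mul]
      ring_nf
    rwa [this, hc, smul_zero, sub_zero]
  · exact ⟨χ, ⟨i, hi, hχ.1⟩, hc⟩

/-- A nonzero sum of at most `N` products of linear forms does not vanish on generic matrices of
dimension `N`. -/
theorem formSum_generic_ne_zero {ι : Type*} (D : ℕ) :
    ∀ (N : ℕ) (S : Finset ι) (c : ι → F) (L : ι → List (Fin n → F)),
      (∀ i ∈ S, (L i).length = D) → S.card ≤ N → formSum S c L (FreeAlgebra.ι F) ≠ 0 →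
        formSum S c L (genericMatrices F n N) ≠ 0 := by
  classical
  induction D with
  | zero =>
    intro N S c L hL hS h0 h
    have hL' : ∀ i ∈ S, L i = [] := fun i hi => List.length_eq_zero_iff.1 (hL i hi)
    have key : ∀ {A : Type u} [Ring A] [Algebra F A] (x : Fin n → A),
        formSum S c L x = (∑ i ∈ S, c i) • (1 : A) := by
      intro A _ _ x
      rw [formSum, Finset.sum_smul]
      exact Finset.sum_congr rfl fun i hi => by simp [hL' i hi, formProd]
    obtain ⟨N, rfl⟩ : ∃ M, N = M + 1 := by
      rcases S.eq_empty_or_nonempty with rfl | h1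
      · simp [formSum] at h0
      · exact Nat.exists_eq_succ_of_ne_zero (by have := h1.card_pos; omega)
    rw [key] at h h0
    rcases smul_eq_zero.1 h with h | h
    · exact h0 (by rw [h, zero_smul])
    · exact one_ne_zero h
  | succ D ih =>
    intro N S c L hL hS h0 h
    obtain ⟨i₀, hi₀⟩ : S.Nonempty := by
      rcases S.eq_empty_or_nonempty with rfl | h1
      · simp [formSum] at h0
      · exact h1
    have hcons : ∀ i ∈ S, L i = ((L i).headD 0) :: (L i).tail := by
      intro i hi
      have := hL i hi
      cases hl : L i with
      | nil => simp [hl] at this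
      | cons a l => rfl
    have htail : ∀ i ∈ S, (L i).tail.length = D := fun i hi => by simp [hL i hi]
    -- Proportional first factors are split off with N unchanged; otherwise both N and the number of
    -- products drop by one.
    by_cases hp : ∃ w : Fin n → F, ∀ i ∈ S, ((L i).headD 0) ∈ Submodule.span F {w}
    · obtain ⟨w, hw⟩ := hp
      have : ∀ i, ∃ r : F, i ∈ S → r • w = ((L i).headD 0) := fun i => by
        by_cases hi : i ∈ S
        · obtain ⟨r, hr⟩ := Submodule.mem_span_singleton.1 (hw i hi)
          exact ⟨r, fun _ => hr⟩
        · exact ⟨0, fun h => absurd h hi⟩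
      choose r hr using this
      have hLr : ∀ i ∈ S, L i = (r i • w) :: (L i).tail := fun i hi => by
        rw [hr i hi]; exact hcons i hi
      rw [formSum_cons_smul S c r w _ L _ hLr] at h h0
      have hw0 : w ≠ 0 := by
        rintro rfl
        simp [linForm] at h0
      refine ih N S _ _ htail hS (right_ne_zero_of_mul h0) ?_
      -- Multiplication by the adjugate turns the left factor into its determinant, a nonzero scalar
      -- in a domain, which can be cancelled.
      have h2 := congrArg (fun X => (linForm w (genericMatrices F n N)).adjugate * X) h
      simp only [← mul_assoc, Matrix.adjugate_mul, mul_zero, smul_mul_assoc, one_mul] at h2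
      exact (smul_eq_zero.1 h2).resolve_left (det_linForm_generic_ne_zero hw0)
    · push Not at hp
      obtain ⟨j, hj, hij⟩ := hp ((L i₀).headD 0)
      obtain ⟨φ, ⟨k, hk, hkφ⟩, hφ⟩ := exists_functional S c _ _ L _ hcons h0 hi₀ hj hij
      obtain ⟨N, rfl⟩ : ∃ M, N = M + 1 :=
        Nat.exists_eq_succ_of_ne_zero (by have := Finset.card_pos.2 ⟨k, hk⟩; omega)
      have herase : ∀ {A : Type u} [Ring A] [Algebra F A] (x : Fin n → A),
          formSum (S.erase k) (fun i => c i * (((L i).headD 0) ⬝ᵥ φ)) (fun i => (L i).tail) x =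
          formSum S (fun i => c i * (((L i).headD 0) ⬝ᵥ φ)) (fun i => (L i).tail) x := by
        intro A _ _ x
        rw [formSum, formSum, Finset.sum_erase]
        simp only [hkφ, mul_zero, zero_smul]
      rw [← herase] at hφ
      have hg := ih N (S.erase k) _ _ (fun i hi => htail i (Finset.mem_of_mem_erase hi))
        (by rw [Finset.card_erase_of_mem hk]; omega) hφ
      apply hg
      ext1 p b
      -- Bordered generic matrices of dimension N are a specialization of the generic ones of
      -- dimension N + 1, where the sum is assumed to vanish. Letting p vary yields every row of the
      -- contracted sum.
      rw [herase, ← formSum_border_zero_succ φ p _ S c _ _ L hcons, formSum_matrix_eq_map, h]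
      simp

/-- The entries of a product of linear forms at generic matrices have bounded degree. -/
theorem totalDegree_formProd_le {N : ℕ} (l : List (Fin n → F)) (a b : Fin N) :
    (formProd l (genericMatrices F n N) a b).totalDegree ≤ l.length := by
  induction l generalizing a with
  | nil =>
    simp only [formProd, List.map_nil, List.prod_nil, Matrix.one_apply]
    split_ifs <;> simp
  | cons v l ih =>
    simp only [formProd, List.map_cons, List.prod_cons, List.length_cons] at ih ⊢
    rw [Matrix.mul_apply]
    refine MvPolynomial.totalDegree_finsetSum_le fun j _ => ?_
    refine (MvPolynomial.totalDegree_mul _ _).trans ?_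
    rw [add_comm]
    refine add_le_add (ih j) ?_
    rw [linForm_apply]
    refine MvPolynomial.totalDegree_finsetSum_le fun k _ => ?_
    refine (MvPolynomial.totalDegree_smul_le _ _).trans ?_
    simp [genericMatrices]

theorem totalDegree_formSum_le {N D : ℕ} {ι : Type*} (S : Finset ι) (c : ι → F)
    (L : ι → List (Fin n → F)) (hL : ∀ i ∈ S, (L i).length ≤ D) (a b : Fin N) :
    (formSum S c L (genericMatrices F n N) a b).totalDegree ≤ D := by
  simp only [formSum, Matrix.sum_apply, Matrix.smul_apply]
  exact MvPolynomial.totalDegree_finsetSum_le fun i hi =>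
    (MvPolynomial.totalDegree_smul_le _ _).trans ((totalDegree_formProd_le _ _ _).trans (hL i hi))

end LinearForms

/-! ### Schwartz–Zippel for non-uniform samples. -/

section SchwartzZippel

open Finset in
/-- The **Schwartz–Zippel lemma** for sample points given by a map whose fibres are small. -/
theorem MvPolynomial.card_zeros_mul_le_of_card_fiber {E Ω : Type*} [Field E] [Fintype Ω]
    [DecidableEq E] (φ : Ω → E) (K : ℕ)
    (hK : ∀ e, K * #{w | φ w = e} ≤ Fintype.card Ω) (n : ℕ) :
    ∀ P : MvPolynomial (Fin n) E, P ≠ 0 →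
      K * #{w : Fin n → Ω | eval (fun i => φ (w i)) P = 0} ≤
        P.totalDegree * Fintype.card Ω ^ n := by
  classical
  induction n with
  | zero =>
    intro P hP
    rw [P.eq_C_of_isEmpty] at hP ⊢
    simp [C_ne_zero.mp hP]
  | succ n ih =>
    intro P hP
    set p' : Polynomial (MvPolynomial (Fin n) E) := finSuccEquiv E n P with hp'
    have hp0 : p' ≠ 0 := EmbeddingLike.map_ne_zero_iff.2 hP
    have hl0 : p'.leadingCoeff ≠ 0 := Polynomial.leadingCoeff_ne_zero.2 hp0
    have hdeg : p'.leadingCoeff.totalDegree + p'.natDegree ≤ P.totalDegree :=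
      totalDegree_coeff_finSuccEquiv_add_le P p'.natDegree hl0
    have hcount : #{w : Fin (n + 1) → Ω | eval (fun i => φ (w i)) P = 0} =
        ∑ w : Fin n → Ω, #{x : Ω | eval (Fin.cons (φ x) fun i => φ (w i) : Fin (n + 1) → E) P = 0} := by
      rw [card_filter, ← (Fin.consEquiv fun _ => Ω).sum_comp, Fintype.sum_prod_type, sum_comm]
      refine sum_congr rfl fun w _ => ?_
      rw [card_filter]
      refine sum_congr rfl fun x _ => ?_
      have : (fun i => φ ((Fin.consEquiv fun _ => Ω) (x, w) i)) =
          (Fin.cons (φ x) fun i => φ (w i) : Fin (n + 1) → E) := by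
        ext i
        refine Fin.cases ?_ (fun i => ?_) i <;> simp [Fin.consEquiv]
      rw [this]
    -- Where the leading coefficient in variable 0 vanishes, the trivial bound is used. Elsewhere
    -- there are at most `natDegree` roots, and each has a fibre of at most |Ω| / K sample points.
    have hfib : ∀ w : Fin n → Ω,
        K * #{x : Ω | eval (Fin.cons (φ x) fun i => φ (w i) : Fin (n + 1) → E) P = 0} ≤
          (if eval (fun i => φ (w i)) p'.leadingCoeff = 0 then K else 0) * Fintype.card Ω +
            p'.natDegree * Fintype.card Ω := by
      intro w
      split_ifs with hw
      · exact (Nat.mul_le_mul_left K (card_le_univ _)).trans (Nat.le_add_right _ _)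
      · rw [zero_mul, zero_add]
        set q := p'.map (eval fun i => φ (w i)) with hq
        have hq0 : q ≠ 0 := fun h => hw <| by
          have := congrArg (fun r => r.coeff p'.natDegree) h
          simpa [hq] using this
        calc K * #{x : Ω | eval (Fin.cons (φ x) fun i => φ (w i) : Fin (n + 1) → E) P = 0}
            ≤ K * ∑ e ∈ q.roots.toFinset, #{x : Ω | φ x = e} := by
              refine Nat.mul_le_mul_left K ?_
              refine (card_le_card (t := q.roots.toFinset.biUnion
                fun e => {x : Ω | φ x = e}) fun x hx => ?_).trans card_biUnion_le
              simp only [mem_filter, mem_univ, true_and, eval_eq_eval_mv_eval'] at hx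
              simp only [mem_biUnion, Multiset.mem_toFinset, Polynomial.mem_roots hq0, mem_filter,
                mem_univ, true_and]
              exact ⟨φ x, hx, rfl⟩
          _ = ∑ e ∈ q.roots.toFinset, K * #{x : Ω | φ x = e} := by rw [mul_sum]
          _ ≤ ∑ e ∈ q.roots.toFinset, Fintype.card Ω := sum_le_sum fun e _ => hK e
          _ = #q.roots.toFinset * Fintype.card Ω := by simp
          _ ≤ p'.natDegree * Fintype.card Ω := by
              refine Nat.mul_le_mul_right _ ?_
              exact (q.roots.toFinset_card_le.trans q.card_roots').trans
                Polynomial.natDegree_map_le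
    calc K * #{w : Fin (n + 1) → Ω | eval (fun i => φ (w i)) P = 0}
        ≤ ∑ w : Fin n → Ω,
          ((if eval (fun i => φ (w i)) p'.leadingCoeff = 0 then K else 0) * Fintype.card Ω +
            p'.natDegree * Fintype.card Ω) := by
          rw [hcount, mul_sum]
          exact sum_le_sum fun w _ => hfib w
      _ = K * #{w : Fin n → Ω | eval (fun i => φ (w i)) p'.leadingCoeff = 0} * Fintype.card Ω +
            p'.natDegree * Fintype.card Ω ^ (n + 1) := by
          rw [sum_add_distrib, ← sum_mul, ← sum_filter]
          simp
          ring
      _ ≤ p'.leadingCoeff.totalDegree * Fintype.card Ω ^ n * Fintype.card Ω +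
            p'.natDegree * Fintype.card Ω ^ (n + 1) := by
          exact Nat.add_le_add_right (Nat.mul_le_mul_right _ (ih _ hl0)) _
      _ = (p'.leadingCoeff.totalDegree + p'.natDegree) * Fintype.card Ω ^ (n + 1) := by ring
      _ ≤ P.totalDegree * Fintype.card Ω ^ (n + 1) := Nat.mul_le_mul_right _ hdeg

open Finset in
theorem MvPolynomial.card_zeros_mul_le_of_card_fiber' {E Ω σ : Type*} [Field E] [Fintype Ω]
    [DecidableEq E] [Fintype σ] [DecidableEq σ] (φ : Ω → E) (K : ℕ)
    (hK : ∀ e, K * #{w | φ w = e} ≤ Fintype.card Ω)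
    (P : MvPolynomial σ E) (hP : P ≠ 0) :
      K * #{w : σ → Ω | eval (fun i => φ (w i)) P = 0} ≤
        P.totalDegree * Fintype.card Ω ^ Fintype.card σ := by
  set e := Fintype.equivFin σ
  have h := card_zeros_mul_le_of_card_fiber φ K hK (Fintype.card σ) (rename e P)
    (by rwa [Ne, map_eq_zero_iff _ (rename_injective _ e.injective)])
  refine le_trans (le_of_eq ?_) (h.trans (Nat.mul_le_mul_right _ (totalDegree_rename_le _ _)))
  congr 1
  refine card_equiv (e.arrowCongr (Equiv.refl Ω)) fun w => ?_
  simp [eval_rename, Function.comp_def]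

end SchwartzZippel

/-! ### Counting irreducible polynomials over prime fields. -/

section Irreducible

open Polynomial

/-- The monic polynomial of degree `t` with lower coefficients `H`. -/
noncomputable def monicOf {R : Type*} [Semiring R] {t : ℕ} (H : Fin t → R) : R[X] :=
  X ^ t + ∑ j : Fin t, C (H j) * X ^ (j : ℕ)

theorem degree_sum_C_mul_X_pow_lt {R : Type*} [Semiring R] {t : ℕ} (H : Fin t → R) :
    (∑ j : Fin t, C (H j) * X ^ (j : ℕ)).degree < (t : WithBot ℕ) := by
  refine (degree_sum_le _ _).trans_lt ((Finset.sup_lt_iff (WithBot.bot_lt_coe t)).2 fun j _ => ?_)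
  exact (degree_C_mul_X_pow_le _ _).trans_lt (WithBot.coe_lt_coe.2 j.2)

theorem monicOf_monic {R : Type*} [Semiring R] {t : ℕ} (H : Fin t → R) : (monicOf H).Monic :=
  monic_X_pow_add (degree_sum_C_mul_X_pow_lt H)

theorem natDegree_monicOf {R : Type*} [Semiring R] [Nontrivial R] {t : ℕ} (H : Fin t → R) :
    (monicOf H).natDegree = t := by
  rw [monicOf, natDegree_add_eq_left_of_degree_lt, natDegree_X_pow]
  rw [degree_X_pow]
  exact degree_sum_C_mul_X_pow_lt H

theorem monicOf_coeff {R : Type*} [Semiring R] {t : ℕ} {f : R[X]} (hf : f.Monic)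
    (ht : f.natDegree = t) : monicOf (fun j : Fin t => f.coeff j) = f := by
  conv_rhs => rw [f.as_sum_range_C_mul_X_pow, ht, Finset.sum_range_succ, ← ht, hf.coeff_natDegree]
  subst ht
  rw [monicOf, add_comm, map_one, one_mul,
    Finset.sum_range fun i => C (f.coeff i) * X ^ i]

theorem sum_range_pow_le {p : ℕ} (hp : 2 ≤ p) (m : ℕ) :
    ∑ d ∈ Finset.range (m + 1), p ^ d ≤ 2 * p ^ m := by
  induction m with
  | zero => simp
  | succ m ih =>
    rw [Finset.sum_range_succ, pow_succ]
    nlinarith [pow_pos (by omega : 0 < p) m]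

/-- At least a fraction `1 / (2 * t)` of the monic polynomials of degree `t` over the field with
`p` elements are irreducible. -/
theorem card_irreducible_monicOf (p t : ℕ) [hp : Fact p.Prime] (ht : 4 ≤ t)
    [DecidablePred fun H : Fin t → ZMod p => Irreducible (monicOf H)] :
    p ^ t ≤ 2 * t * (Finset.univ.filter fun H : Fin t → ZMod p => Irreducible (monicOf H)).card := by
  classical
  set K := GaloisField p t
  let : Fintype K := Fintype.ofFinite K
  have hcard : Fintype.card K = p ^ t := by
    rw [← Nat.card_eq_fintype_card]; exact GaloisField.card p t (by omega)
  have hint : ∀ x : K, IsIntegral (ZMod p) x := fun x => Algebra.IsIntegral.isIntegral x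
  set A : Finset K := Finset.univ.filter fun x => (minpoly (ZMod p) x).natDegree = t with hA
  set I := Finset.univ.filter fun H : Fin t → ZMod p => Irreducible (monicOf H) with hI
  -- Elements of degree t go to their minimal polynomials, and a polynomial of degree t has at most
  -- t roots.
  have h1 : A.card ≤ t * I.card := by
    refine Finset.card_le_mul_card_image_of_maps_to
      (f := fun x (j : Fin t) => (minpoly (ZMod p) x).coeff j) (fun x hx => ?_) t fun H hH => ?_
    · simp only [hA, Finset.mem_filter, Finset.mem_univ, true_and] at hx
      simp only [hI, Finset.mem_filter, Finset.mem_univ, true_and]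
      rw [monicOf_coeff (minpoly.monic (hint x)) hx]
      exact minpoly.irreducible (hint x)
    · set q := (monicOf H).map (algebraMap (ZMod p) K) with hq
      have hq0 : q ≠ 0 := ((monicOf_monic H).map _).ne_zero
      calc _ ≤ q.roots.toFinset.card := Finset.card_le_card fun x hx => by
            simp only [hA, Finset.mem_filter, Finset.mem_univ, true_and] at hx
            rw [Multiset.mem_toFinset, mem_roots hq0, hq, ← hx.2,
              monicOf_coeff (minpoly.monic (hint x)) hx.1, IsRoot, eval_map_algebraMap,
              minpoly.aeval]
        _ ≤ _ := q.roots.toFinset_card_le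
        _ ≤ _ := q.card_roots'
        _ ≤ t := by rw [hq, natDegree_map, natDegree_monicOf]
  -- The other elements have as degree a proper divisor d ≤ t / 2 of t, hence are roots of X^(p^d) -
  -- X.
  have h2 : (Finset.univ \ A).card ≤ ∑ d ∈ Finset.range (t / 2 + 1), p ^ d := by
    have : (Finset.univ \ A) ⊆ (Finset.range (t / 2 + 1)).biUnion fun d =>
        Finset.univ.filter fun x : K => d ≠ 0 ∧ x ^ p ^ d = x := by
      intro x hx
      simp only [hA, Finset.mem_sdiff, Finset.mem_filter, Finset.mem_univ, true_and] at hx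
      have hirr := minpoly.irreducible (hint x)
      have hd : (minpoly (ZMod p) x).natDegree ∣ t := by
        have := minpoly.degree_dvd (hint x)
        rwa [GaloisField.finrank p (by omega)] at this
      have hr := (hirr.natDegree_dvd_iff_dvd_X_pow_card_pow_sub_X).1 dvd_rfl
      have hz := aeval_eq_zero_of_dvd_aeval_eq_zero hr (minpoly.aeval (ZMod p) x)
      simp only [Nat.card_zmod, map_sub, map_pow, aeval_X, sub_eq_zero] at hz
      simp only [Finset.mem_biUnion, Finset.mem_range, Finset.mem_filter, Finset.mem_univ, true_and]
      refine ⟨_, ?_, (minpoly.natDegree_pos (hint x)).ne', hz⟩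
      obtain ⟨e, he⟩ := hd
      have he1 : 2 ≤ e := by
        rcases e with _ | _ | e
        · omega
        · omega
        · omega
      have := Nat.mul_le_mul_left (minpoly (ZMod p) x).natDegree he1
      omega
    refine (Finset.card_le_card this).trans (Finset.card_biUnion_le.trans
      (Finset.sum_le_sum fun d _ => ?_))
    by_cases hd : d = 0
    · simp [hd]
    · have hp1 : 1 < p := hp.out.one_lt
      have hne : (X ^ p ^ d - X : K[X]) ≠ 0 := FiniteField.X_pow_card_pow_sub_X_ne_zero K hd hp1
      calc _ ≤ (X ^ p ^ d - X : K[X]).roots.toFinset.card := Finset.card_le_card fun x hx => by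
            simp only [Finset.mem_filter, Finset.mem_univ, true_and] at hx
            simp [hne, hx.2]
        _ ≤ _ := Multiset.toFinset_card_le _
        _ ≤ _ := card_roots' _
        _ = p ^ d := FiniteField.X_pow_card_pow_sub_X_natDegree_eq K hd hp1
  have h3 : A.card + (Finset.univ \ A).card = p ^ t := by
    rw [← hcard, ← Finset.card_univ, add_comm]
    exact Finset.card_sdiff_add_card_eq_card (Finset.subset_univ A)
  have h4 := sum_range_pow_le hp.out.two_le (t / 2)
  -- Here t ≥ 4 enters, as t / 2 + 2 ≤ t. The elements of smaller degree, at most 2 p^(t / 2) by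
  -- `h4`, then make up at most half of the field.
  have h5 : p ^ (t / 2) * 4 ≤ p ^ t := by
    calc p ^ (t / 2) * 4 ≤ p ^ (t / 2) * p ^ 2 :=
          Nat.mul_le_mul_left _ (Nat.pow_le_pow_left hp.out.two_le 2)
      _ = p ^ (t / 2 + 2) := (pow_add _ _ _).symm
      _ ≤ p ^ t := Nat.pow_le_pow_right hp.out.pos (by omega)
  have h6 : 2 * t * I.card = 2 * (t * I.card) := by ring
  omega

end Irreducible

/-! ### From circuits to sums of products of linear forms. -/

namespace NCCircuit

variable {F : Type u} [Field F] {n : ℕ}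

/-- Evaluation commutes with algebra homomorphisms, so every value of the circuit is an image of its
polynomial. This makes the error one-sided. -/
theorem map_nodeVal {A : Type*} {B : Type*} [Ring A] [Algebra F A] [Ring B] [Algebra F B]
    (f : A →ₐ[F] B) (C : NCCircuit F n) (x : Fin n → A) (i : Fin C.numGates) :
    f (C.nodeVal x i) = C.nodeVal (fun k => f (x k)) i := by
  induction hi : (i : ℕ) using Nat.strong_induction_on generalizing i with
  | _ m ih =>
    subst hi
    have ih' : ∀ j : Fin (i : ℕ), f (C.nodeVal x (C.input i j)) =
        C.nodeVal (fun k => f (x k)) (C.input i j) := fun j => ih j j.2 _ rfl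
    rw [nodeVal, nodeVal]
    cases C.gate i with
    | var k => rfl
    | const c => simp
    | sum l => simp [map_list_sum, Function.comp_def, ih']
    | prod l => simp [map_list_prod, Function.comp_def, ih']

theorem eval_eq_lift_poly {A : Type*} [Ring A] [Algebra F A] (C : NCCircuit F n) (x : Fin n → A) :
    C.eval x = FreeAlgebra.lift F x C.poly := by
  rw [poly, eval, eval, map_nodeVal]
  simp

theorem blackBox_eq_zero_of_poly_eq_zero (C : NCCircuit F n) (h : C.poly = 0) (d : ℕ)
    (M : Fin n → Matrix (Fin d) (Fin d) F) : C.blackBox d M = 0 := by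
  rw [blackBox, eval_eq_lift_poly, h, map_zero]

theorem IsLinearForm.exists_linForm {C : NCCircuit F n} {i : Fin C.numGates}
    (h : C.IsLinearForm i) :
    C.syntDegree i = 1 ∧ ∃ v : Fin n → F, ∀ (A : Type u) [Ring A] [Algebra F A] (x : Fin n → A),
      C.nodeVal x i = linForm v x := by
  obtain ⟨l, hl, hne, hvar⟩ := h
  constructor
  · rw [syntDegree, hl]
    have h1 : ∀ e ∈ l, C.syntDegree (C.input i e.2) = 1 := fun e he => by
      obtain ⟨k, hk⟩ := hvar e he
      rw [syntDegree, hk]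
    dsimp only
    rw [List.map_congr_left h1]
    clear hl hvar h1
    induction l with
    | nil => exact absurd rfl hne
    | cons e l ih =>
      rcases eq_or_ne l [] with rfl | h
      · simp
      · rw [List.map_cons, List.foldr_cons, ih h]
        rfl
  · have key : ∀ m : List (F × Fin (i : ℕ)),
        (∀ e ∈ m, ∃ k : Fin n, C.gate (C.input i e.2) = .var k) →
        ∃ v : Fin n → F, ∀ (A : Type u) [Ring A] [Algebra F A] (x : Fin n → A),
          (m.map fun e => e.1 • C.nodeVal x (C.input i e.2)).sum = linForm v x := by
      intro m hm
      induction m with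
      | nil => exact ⟨0, fun A _ _ x => by simp [linForm]⟩
      | cons e m ih =>
        obtain ⟨v, hv⟩ := ih fun e he => hm e (List.mem_cons_of_mem _ he)
        obtain ⟨k, hk⟩ := hm e List.mem_cons_self
        refine ⟨e.1 • Pi.single k 1 + v, fun A _ _ x => ?_⟩
        rw [List.map_cons, List.sum_cons, hv, nodeVal, hk]
        simp [linForm, add_smul, Finset.sum_add_distrib, Pi.single_apply]
    obtain ⟨v, hv⟩ := key l hvar
    refine ⟨v, fun A _ _ x => ?_⟩
    rw [nodeVal, hl]
    exact hv A x

theorem IsPiGate.exists_formProd {C : NCCircuit F n} (i : Fin C.numGates) (h : C.IsPiGate i) :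
    ∃ L : List (Fin n → F), L.length = C.syntDegree i ∧
      ∀ (A : Type u) [Ring A] [Algebra F A] (x : Fin n → A), C.nodeVal x i = formProd L x := by
  induction hi : (i : ℕ) using Nat.strong_induction_on generalizing i with
  | _ m ih =>
    subst hi
    rw [IsPiGate] at h
    cases hg : C.gate i with
    | prod l =>
      rw [hg] at h
      have key : ∀ m : List (Fin (i : ℕ)),
          (∀ j ∈ m, C.IsLinearForm (C.input i j) ∨ C.IsPiGate (C.input i j)) →
          ∃ L : List (Fin n → F),
            L.length = (m.map fun j => C.syntDegree (C.input i j)).sum ∧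
            ∀ (A : Type u) [Ring A] [Algebra F A] (x : Fin n → A),
              (m.map fun j => C.nodeVal x (C.input i j)).prod = formProd L x := by
        intro m hm
        induction m with
        | nil => exact ⟨[], rfl, fun A _ _ x => by simp [formProd]⟩
        | cons j m ihm =>
          obtain ⟨L, hL, hL'⟩ := ihm fun j hj => hm j (List.mem_cons_of_mem _ hj)
          obtain ⟨K, hK, hK'⟩ : ∃ K : List (Fin n → F), K.length = C.syntDegree (C.input i j) ∧
              ∀ (A : Type u) [Ring A] [Algebra F A] (x : Fin n → A),
                C.nodeVal x (C.input i j) = formProd K x := by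
            rcases hm j List.mem_cons_self with h1 | h1
            · obtain ⟨hd, v, hv⟩ := h1.exists_linForm
              exact ⟨[v], by simp [hd], fun A _ _ x => by simp [formProd, hv]⟩
            · exact ih j j.2 _ h1 rfl
          refine ⟨K ++ L, by simp [hK, hL], fun A _ _ x => ?_⟩
          rw [List.map_cons, List.prod_cons, hL', hK']
          simp [formProd]
      obtain ⟨L, hL, hL'⟩ := key l h.2
      refine ⟨L, ?_, fun A _ _ x => ?_⟩
      · rw [hL, syntDegree, hg]
      · rw [← hL', nodeVal, hg]
    | var k => rw [hg] at h; exact h.elim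
    | const k => rw [hg] at h; exact h.elim
    | sum k => rw [hg] at h; exact h.elim

omit [Field F] in
-- A product node of fan-in ℓ multiplies the degree by at most ℓ ≤ 2^ℓ, and each node is charged
-- once. Iterated products really make the degree exponential, but only its logarithm enters the
-- algorithm.
theorem syntDegree_le (C : NCCircuit F n) (i : Fin C.numGates) :
    C.syntDegree i ≤ 2 ^ ∑ j : Fin C.numGates with j ≤ i, (C.gate j).fanIn := by
  induction hi : (i : ℕ) using Nat.strong_induction_on generalizing i with
  | _ m ih =>
    subst hi
    set W := ∑ j : Fin C.numGates with j < i, (C.gate j).fanIn with hW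
    have hsplit : ∑ j : Fin C.numGates with j ≤ i, (C.gate j).fanIn = (C.gate i).fanIn + W := by
      have : (Finset.univ.filter fun j => j ≤ i) = insert i (Finset.univ.filter fun j => j < i) := by
        ext j
        simp [le_iff_eq_or_lt]
      rw [this, Finset.sum_insert (by simp)]
    have ih' : ∀ j : Fin (i : ℕ), C.syntDegree (C.input i j) ≤ 2 ^ W := fun j => by
      refine (ih j j.2 _ rfl).trans (Nat.pow_le_pow_right two_pos ?_)
      refine Finset.sum_le_sum_of_subset fun k hk => ?_
      simp only [Finset.mem_filter, Finset.mem_univ, true_and] at hk ⊢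
      exact lt_of_le_of_lt hk j.2
    rw [hsplit, syntDegree]
    cases C.gate i with
    | var k => exact Nat.one_le_two_pow
    | const k => exact Nat.zero_le _
    | sum l =>
      refine le_trans ?_ (Nat.pow_le_pow_right two_pos (Nat.le_add_left W _))
      dsimp only
      induction l with
      | nil => simp
      | cons e l ihl => simpa using ⟨ih' e.2, by simpa using ihl⟩
    | prod l =>
      dsimp only [NCGate.fanIn]
      have : (l.map fun j => C.syntDegree (C.input i j)).sum ≤ l.length * 2 ^ W := by
        have := List.sum_le_card_nsmul (l.map fun j => C.syntDegree (C.input i j)) (2 ^ W)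
          (by simpa using fun a _ => ih' a)
        simpa using this
      rw [pow_add]
      exact this.trans (Nat.mul_le_mul_right _ Nat.lt_two_pow_self.le)

omit [Field F] in
theorem syntDegree_le_two_pow_size (C : NCCircuit F n) (i : Fin C.numGates) :
    C.syntDegree i ≤ 2 ^ C.size := by
  refine (C.syntDegree_le i).trans (Nat.pow_le_pow_right two_pos ?_)
  refine (Finset.sum_le_sum_of_subset (Finset.filter_subset _ _)).trans ?_
  exact Finset.sum_le_sum fun j _ => Nat.le_add_left _ _

/-- A homogeneous `ΣΠ*Σ` circuit computes a short sum of products of linear forms. -/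
theorem IsHomogeneousSigmaPiStarSigma.exists_formSum {C : NCCircuit F n}
    (h : C.IsHomogeneousSigmaPiStarSigma) :
    ∃ (k D : ℕ) (c : Fin k → F) (L : Fin k → List (Fin n → F)), k ≤ C.size ∧ D ≤ 2 ^ C.size ∧
      (∀ i, (L i).length = D) ∧
      ∀ (A : Type u) [Ring A] [Algebra F A] (x : Fin n → A),
        C.eval x = formSum Finset.univ c L x := by
  obtain ⟨l, hl, hpi, D, hD⟩ := h
  have hsize : l.length ≤ C.size := by
    refine le_trans ?_ (Finset.single_le_sum (f := fun i => 1 + (C.gate i).fanIn)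
      (fun _ _ => Nat.zero_le _) (Finset.mem_univ C.out))
    rw [hl]
    exact Nat.le_add_left _ _
  have h1 := fun i : Fin l.length => (hpi l[i] (List.getElem_mem _)).exists_formProd
  choose L hL hL' using h1
  have hval : ∀ (A : Type u) [Ring A] [Algebra F A] (x : Fin n → A),
      C.eval x = formSum Finset.univ (fun i : Fin l.length => l[i].1) L x := by
    intro A _ _ x
    rw [eval, nodeVal, hl, formSum]
    dsimp only
    rw [← List.sum_ofFn]
    congr 1
    refine List.ext_getElem (by simp) fun m h1 h2 => ?_
    simp only [List.getElem_map, List.getElem_ofFn]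
    rw [← hL']
    rfl
  -- If the output gate has no inputs, the common degree D is arbitrary and unbounded, so it is
  -- replaced by 0.
  rcases Nat.eq_zero_or_pos l.length with h0 | h0
  · exact ⟨l.length, 0, _, L, hsize, Nat.zero_le _, fun i => absurd i.2 (by omega), hval⟩
  · refine ⟨l.length, D, _, L, hsize, ?_, fun i => (hL i).trans (hD _ (List.getElem_mem i.2)), hval⟩
    rw [← hD l[0] (List.getElem_mem _)]
    exact C.syntDegree_le_two_pow_size _

end NCCircuit

/-! ### Replacing scalars of an extension field by multiplication matrices. -/

section Blocks

variable {F : Type u} [Field F] {n : ℕ}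

/-- The relation M k * W = W * U k passes to linear combinations and to products, hence to any
noncommutative polynomial. -/
theorem formSum_intertwine {R : Type*} [CommRing R] [Algebra F R] {d N : ℕ} {ι : Type*}
    (S : Finset ι) (c : ι → F) (L : ι → List (Fin n → F))
    (M : Fin n → Matrix (Fin d) (Fin d) R) (U : Fin n → Matrix (Fin N) (Fin N) R)
    (W : Matrix (Fin d) (Fin N) R) (h : ∀ k, M k * W = W * U k) :
    formSum S c L M * W = W * formSum S c L U := by
  have h1 : ∀ v : Fin n → F, linForm v M * W = W * linForm v U := fun v => by
    simp [linForm, Matrix.sum_mul, Matrix.mul_sum, h]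
  have h2 : ∀ l : List (Fin n → F), formProd l M * W = W * formProd l U := fun l => by
    induction l with
    | nil => simp [formProd]
    | cons v l ih =>
      simp only [formProd, List.map_cons, List.prod_cons] at ih ⊢
      rw [Matrix.mul_assoc, ih, ← Matrix.mul_assoc, h1, Matrix.mul_assoc]
  simp [formSum, Matrix.sum_mul, Matrix.mul_sum, h2]

/-- The array `e` with rows of length `N * N` lists the rows of `n` block matrices.  The blocks are
the `N × N` matrices of multiplication by `∑ v j * y ^ j` modulo `y ^ N + ∑ v β * y ^ β`: each row
is `y` times the row above it. -/
structure IsBlockArray (n N : ℕ) (v : ℕ → ℕ) (e : ℕ → ℕ → F) : Prop where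
  first : ∀ g < n * N, ∀ c < N * N, e (g * N) c = v (N + (g * (N * N) + c))
  step : ∀ g < n * N, ∀ α, α + 1 < N → ∀ b < N, ∀ β < N,
    e (g * N + (α + 1)) (b * N + β) =
      (if β = 0 then 0 else e (g * N + α) (b * N + (β - 1))) -
        e (g * N + α) (b * N + (N - 1)) * v β

/-- The matrices listed by an array. -/
def arrayMatrices (n N : ℕ) (e : ℕ → ℕ → F) : Fin n → Matrix (Fin (N * N)) (Fin (N * N)) F :=
  fun k => Matrix.of fun i j => e (k * (N * N) + i) j

/-- Read a row as a residue modulo the monic polynomial with lower coefficients h. The recursion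
multiplies by the variable, and evaluation at a root θ respects this. So (1, θ, …, θ^(N-1)) is an
eigenvector of the block, with the value of row 0 at θ as eigenvalue. -/
theorem sum_row_eq {K : Type*} [CommRing K] (N : ℕ) (R : ℕ → ℕ → K) (h : ℕ → K) (θ : K)
    (hθ : θ ^ N + ∑ β ∈ Finset.range N, h β * θ ^ β = 0)
    (hR : ∀ α, α + 1 < N → ∀ β < N,
      R (α + 1) β = (if β = 0 then 0 else R α (β - 1)) - R α (N - 1) * h β) :
    ∀ α < N, ∑ β ∈ Finset.range N, R α β * θ ^ β =
      θ ^ α * ∑ β ∈ Finset.range N, R 0 β * θ ^ β := by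
  intro α hα
  induction α with
  | zero => simp
  | succ α ih =>
    rw [pow_succ', mul_assoc, ← ih (by omega)]
    rw [Finset.sum_congr rfl fun β hβ => by rw [hR α hα β (Finset.mem_range.1 hβ)]]
    obtain ⟨N, rfl⟩ : ∃ M, N = M + 1 := ⟨N - 1, by omega⟩
    simp only [sub_mul, Finset.sum_sub_distrib, mul_assoc]
    rw [← Finset.mul_sum, eq_neg_of_add_eq_zero_right hθ, Finset.sum_range_succ',
      Finset.sum_range_succ, mul_add, Finset.mul_sum]
    simp only [Nat.add_sub_cancel, if_true, zero_mul, add_zero, Nat.succ_ne_zero, if_false]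
    rw [mul_neg, sub_neg_eq_add]
    congr 1
    · exact Finset.sum_congr rfl fun β _ => by ring
    · ring

/-- If a polynomial vanishes at the matrices listed by a block array, it vanishes at the smaller
matrices over an extension field in which the blocks are replaced by eigenvalues. -/
theorem formSum_eigen_eq_zero {K : Type*} [Field K] [Algebra F K] {N : ℕ} (hN : 0 < N)
    {v : ℕ → ℕ} {e : ℕ → ℕ → F} (he : IsBlockArray n N v e) (θ : K)
    (hθ : θ ^ N + ∑ β ∈ Finset.range N, (v β : K) * θ ^ β = 0)
    {ι : Type*} (S : Finset ι) (c : ι → F) (L : ι → List (Fin n → F))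
    (h : formSum S c L (arrayMatrices n N e) = 0) :
    formSum S c L (fun k => Matrix.of fun a b : Fin N => ∑ j ∈ Finset.range N,
      (v (N + ((k * N + a) * (N * N) + (b * N + j))) : K) * θ ^ j) = 0 := by
  set U : Fin n → Matrix (Fin N) (Fin N) K := fun k => Matrix.of fun a b : Fin N =>
    ∑ j ∈ Finset.range N, (v (N + ((k * N + a) * (N * N) + (b * N + j))) : K) * θ ^ j with hU
  -- Column a of W carries the common eigenvector in the a-th block of coordinates.
  set W : Matrix (Fin (N * N)) (Fin N) K := Matrix.of fun i a =>
    if (i : ℕ) / N = a then θ ^ ((i : ℕ) % N) else 0 with hW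
  have hint : ∀ k, (arrayMatrices n N e k).map (algebraMap F K) * W = W * U k := by
    intro k
    ext i b
    obtain ⟨⟨a, α⟩, rfl⟩ := finProdFinEquiv.surjective i
    have hdiv : ∀ x y : Fin N, ((finProdFinEquiv (x, y) : Fin (N * N)) : ℕ) / N = x := fun x y => by
      rw [finProdFinEquiv_apply_val, Nat.add_mul_div_left _ _ hN, Nat.div_eq_of_lt y.2, zero_add]
    have hmod : ∀ x y : Fin N, ((finProdFinEquiv (x, y) : Fin (N * N)) : ℕ) % N = y := fun x y => by
      rw [finProdFinEquiv_apply_val, Nat.add_mul_mod_self_left, Nat.mod_eq_of_lt y.2]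
    have hk : (k : ℕ) * N + a < n * N :=
      calc (k : ℕ) * N + a < k * N + N := Nat.add_lt_add_left a.2 _
        _ = (k + 1) * N := by ring
        _ ≤ n * N := Nat.mul_le_mul_right _ k.2
    rw [Matrix.mul_apply, Matrix.mul_apply, ← finProdFinEquiv.sum_comp, Fintype.sum_prod_type]
    simp only [hW, Matrix.of_apply, hdiv, hmod, Fin.val_inj, Matrix.map_apply]
    rw [Finset.sum_eq_single b (fun x _ hx => by simp [hx]) (by simp)]
    simp only [if_true, ite_mul, zero_mul, Finset.sum_ite_eq, Finset.mem_univ, hU, Matrix.of_apply, arrayMatrices, finProdFinEquiv_apply_val]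
    rw [← Finset.sum_range fun β =>
      algebraMap F K (e (k * (N * N) + (α + N * a)) (β + N * b)) * θ ^ β]
    have := sum_row_eq N (fun α β => algebraMap F K (e ((k * N + a) * N + α) (b * N + β)))
      (fun β => (v β : K)) θ hθ (fun α hα β hβ => by
        rw [he.step _ hk α hα b b.2 β hβ]
        split_ifs <;> simp) α α.2
    refine Eq.trans ?_ (this.trans ?_)
    · refine Finset.sum_congr rfl fun β _ => ?_
      congr 3 <;> ring
    · congr 1
      refine Finset.sum_congr rfl fun β hβ => ?_
      have hβ' := Finset.mem_range.1 hβ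
      have hb : (b : ℕ) * N + β < N * N :=
        calc (b : ℕ) * N + β < b * N + N := Nat.add_lt_add_left hβ' _
          _ = (b + 1) * N := by ring
          _ ≤ N * N := Nat.mul_le_mul_right _ b.2
      rw [add_zero, he.first _ hk _ hb, map_natCast]
  have h1 := formSum_intertwine S c L _ U W hint
  have h2 : formSum S c L (fun k => (arrayMatrices n N e k).map (algebraMap F K)) = 0 := by
    have := map_formSum ((Algebra.ofId F K).mapMatrix (m := Fin (N * N))) S c L
      (arrayMatrices n N e)
    rw [h, map_zero] at this
    exact this.symm
  rw [h2, Matrix.zero_mul] at h1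
  ext a b
  -- The row of W with index (a, 0) is the a-th unit vector because θ^0 = 1, so W can be cancelled
  -- on the left even if θ = 0.
  have h3 := congrFun (congrFun h1 (finProdFinEquiv (a, ⟨0, hN⟩))) b
  have h4 : (N * (a : ℕ)) / N = a := Nat.mul_div_cancel_left _ hN
  rw [Matrix.mul_apply, Finset.sum_eq_single a] at h3
  · simpa [hW, h4] using h3.symm
  · intro x _ hx
    simp [hW, h4, Fin.val_inj, hx.symm]
  · simp

end Blocks

/-! ### How far the values of random polynomials at θ are spread. -/

section Sampling

open Polynomial

theorem Nat.eq_of_modEq_of_div_eq {a b p μ : ℕ} (h : a ≡ b [MOD p]) (hp : p = 0 ∨ μ ≤ p)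
    (hμ : 0 < μ) (hd : a / μ = b / μ) : a = b := by
  rcases hp with rfl | hp
  · simpa [Nat.ModEq] using h
  · have ha := Nat.div_add_mod a μ
    have hb := Nat.div_add_mod b μ
    have ha' := Nat.mod_lt a hμ
    have hb' := Nat.mod_lt b hμ
    rw [hd] at ha
    rcases le_total a b with hab | hab
    · have := (Nat.modEq_iff_dvd' hab).1 h
      have := Nat.eq_zero_of_dvd_of_lt this (by omega)
      omega
    · have := (Nat.modEq_iff_dvd' hab).1 h.symm
      have := Nat.eq_zero_of_dvd_of_lt this (by omega)
      omega

/-- Keep the quotients by μ j of a point of the fibre and replace its remainders by arbitrary ones.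
The quotients determine the point within the fibre, so this embeds (remainders) × (fibre) in the
whole space; divisibility of Q by μ j keeps the new coordinates below Q. -/
theorem card_fiber_mul_le {E : Type*} [DecidableEq E] {N Q : ℕ} (φ : (Fin N → Fin Q) → E)
    (μ : Fin N → ℕ) (hμ : ∀ j, μ j ∣ Q)
    (hinj : ∀ x y, φ x = φ y → (∀ j, (x j : ℕ) / μ j = y j / μ j) → x = y) (e : E) :
    (∏ j, μ j) * (Finset.univ.filter fun x => φ x = e).card ≤
      Fintype.card (Fin N → Fin Q) := by
  have hpos : ∀ j, (Fin (μ j)) → 0 < μ j := fun j r => r.pos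
  have hlt : ∀ j (r : Fin (μ j)) (x : Fin Q), (x : ℕ) / μ j * μ j + r < Q := by
    intro j r x
    obtain ⟨q, hq⟩ := hμ j
    have h1 : (x : ℕ) / μ j < q := Nat.div_lt_of_lt_mul (hq ▸ x.2)
    calc (x : ℕ) / μ j * μ j + r < (x : ℕ) / μ j * μ j + μ j := Nat.add_lt_add_left r.2 _
      _ = (x / μ j + 1) * μ j := by ring
      _ ≤ q * μ j := Nat.mul_le_mul_right _ h1
      _ = Q := by rw [hq, mul_comm]
  have := Fintype.card_le_of_injective
    (fun z : (∀ j, Fin (μ j)) × {x // φ x = e} => fun j =>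
      (⟨(z.2.1 j : ℕ) / μ j * μ j + z.1 j, hlt j _ _⟩ : Fin Q)) (by
    rintro ⟨r, x, hx⟩ ⟨s, y, hy⟩ h
    have h1 : ∀ j, (x j : ℕ) / μ j * μ j + r j = (y j : ℕ) / μ j * μ j + s j := fun j =>
      congrArg Fin.val (congrFun h j)
    have h2 : ∀ j, (x j : ℕ) / μ j = (y j : ℕ) / μ j := fun j => by
      have := congrArg (· / μ j) (h1 j)
      simpa [Nat.mul_add_div, mul_comm _ (μ j), hpos j (r j), Nat.div_eq_of_lt] using this
    have h3 : ∀ j, r j = s j := fun j => by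
      have := h1 j
      rw [h2 j] at this
      exact Fin.ext (Nat.add_left_cancel this)
    have h4 := hinj x y (hx.trans hy.symm) h2
    subst h4
    simp [funext h3])
  simpa [Fintype.card_subtype] using this

/-- In characteristic `0` or large characteristic, the constant terms alone spread the values of
random polynomials. -/
theorem card_fiber_of_large_char {E : Type*} [Field E] [DecidableEq E] (p : ℕ) [CharP E p] {N m : ℕ}
    (hN : 0 < N) (hm : N ≤ m) (hp : p = 0 ∨ 2 ^ N ≤ p) (θ e : E) :
    2 ^ N * (Finset.univ.filter fun x : Fin N → Fin (2 ^ m) =>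
      ∑ j, ((x j : ℕ) : E) * θ ^ (j : ℕ) = e).card ≤ Fintype.card (Fin N → Fin (2 ^ m)) := by
  have := card_fiber_mul_le (fun x : Fin N → Fin (2 ^ m) => ∑ j, ((x j : ℕ) : E) * θ ^ (j : ℕ))
    -- All the freedom sits in coordinate 0, whose coefficient θ^0 = 1 does not depend on θ: 2^N
    -- consecutive numbers stay distinct in E.
    (fun j => if j = ⟨0, hN⟩ then 2 ^ N else 1)
    (fun j => by split_ifs; exacts [pow_dvd_pow _ hm, one_dvd _]) (fun x y h hd => by
      have h1 : ∀ j, j ≠ ⟨0, hN⟩ → x j = y j := fun j hj => by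
        have := hd j
        simp only [hj, if_false, Nat.div_one] at this
        exact Fin.ext this
      rw [← Finset.add_sum_erase _ _ (Finset.mem_univ ⟨0, hN⟩),
        ← Finset.add_sum_erase _ _ (Finset.mem_univ ⟨0, hN⟩),
        Finset.sum_congr rfl fun j hj => by rw [h1 j (Finset.ne_of_mem_erase hj)]] at h
      have h2 := add_right_cancel h
      simp only [pow_zero, mul_one] at h2
      rw [CharP.natCast_eq_natCast E p] at h2
      funext j
      by_cases hj : j = ⟨0, hN⟩
      · subst hj
        have := hd ⟨0, hN⟩
        rw [if_pos rfl] at this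
        exact Fin.ext (Nat.eq_of_modEq_of_div_eq h2 hp (by positivity) this)
      · exact h1 j hj) e
  simpa using this

/-- At a root of an irreducible polynomial of degree `N` over the prime field, the values of random
polynomials are spread. -/
theorem card_fiber_of_irreducible {E : Type*} [Field E] [DecidableEq E] (p : ℕ) [CharP E p]
    [Fact p.Prime] {N m : ℕ} (hm : 0 < m) (H : Fin N → ℕ) (θ e : E)
    (hH : Irreducible (monicOf fun j => (H j : ZMod p)))
    (hθ : θ ^ N + ∑ j : Fin N, (H j : E) * θ ^ (j : ℕ) = 0) :
    2 ^ N * (Finset.univ.filter fun x : Fin N → Fin (2 ^ m) =>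
      ∑ j, ((x j : ℕ) : E) * θ ^ (j : ℕ) = e).card ≤ Fintype.card (Fin N → Fin (2 ^ m)) := by
  let _ : Algebra (ZMod p) E := ZMod.algebra E p
  have hroot : aeval θ (monicOf fun j => (H j : ZMod p)) = 0 := by
    simpa [monicOf] using hθ
  have := card_fiber_mul_le (fun x : Fin N → Fin (2 ^ m) => ∑ j, ((x j : ℕ) : E) * θ ^ (j : ℕ))
    -- One free bit in each of the N coordinates suffices. Equal values at θ mean that a difference
    -- polynomial of degree less than N is divisible by an irreducible one of degree N, so the
    -- coordinates agree modulo p ≥ 2.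
    (fun j => 2) (fun j => dvd_pow_self 2 hm.ne') (fun x y h hd => by
      set q : (ZMod p)[X] := ∑ j : Fin N, C (((x j : ℕ) : ZMod p) - ((y j : ℕ) : ZMod p)) *
        X ^ (j : ℕ) with hq
      have hq0 : aeval θ q = 0 := by
        simp only [hq, map_sum, map_mul, map_sub, map_natCast, map_pow, aeval_X, sub_mul,
          Finset.sum_sub_distrib]
        exact sub_eq_zero.2 h
      have hdvd : (monicOf fun j => (H j : ZMod p)) ∣ q :=
        (hH.dvd_iff_aeval_eq_zero hroot).1 hq0
      have hz : q = 0 := eq_zero_of_dvd_of_degree_lt hdvd (by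
        rw [degree_eq_natDegree (monicOf_monic _).ne_zero, natDegree_monicOf]
        exact degree_sum_C_mul_X_pow_lt _)
      funext j
      have hc := congrArg (fun r => r.coeff (j : ℕ)) hz
      simp only [hq, finsetSum_coeff, coeff_C_mul, coeff_X_pow, coeff_zero, Fin.val_inj, mul_ite,
        mul_one, mul_zero, Finset.sum_ite_eq, Finset.mem_univ, if_true, sub_eq_zero] at hc
      rw [CharP.natCast_eq_natCast (ZMod p) p] at hc
      exact Fin.ext (Nat.eq_of_modEq_of_div_eq hc (Or.inr (Fact.out : p.Prime).two_le) two_pos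
        (hd j))) e
  simpa using this

end Sampling

/-! ### Probability that random moduli and coefficients are good. -/

section Counting

open Polynomial

theorem two_mul_le_two_pow {N : ℕ} (hN : 3 ≤ N) : 2 * N ≤ 2 ^ N := by
  induction N, hN using Nat.le_induction with
  | base => norm_num
  | succ k hk ih => rw [pow_succ]; omega

/-- Bernoulli: (1 - 1/X)^N ≥ 1 - N/X ≥ 1/2. -/
theorem pow_le_two_mul_sub_one_pow {X N : ℕ} (hX : 0 < X) (h : 2 * N ≤ X) :
    X ^ N ≤ 2 * (X - 1) ^ N := by
  have hX' : (0 : ℝ) < X := by exact_mod_cast hX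
  have h1 : (1 : ℝ) + N * (-1 / X) ≤ (1 + -1 / X) ^ N := by
    refine one_add_mul_le_pow ?_ N
    rw [neg_div]
    have : (1 : ℝ) / X ≤ 1 := by
      rw [div_le_one hX']; exact_mod_cast hX
    linarith
  have h2 : (1 : ℝ) / 2 ≤ 1 + N * (-1 / X) := by
    have : (N : ℝ) * (1 / X) ≤ 1 / 2 := by
      rw [mul_one_div, div_le_div_iff₀ hX' two_pos]
      have : ((2 * N : ℕ) : ℝ) ≤ X := by exact_mod_cast h
      push_cast at this
      linarith
    have e : (N : ℝ) * (-1 / X) = -(N * (1 / X)) := by ring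
    rw [e]; linarith
  have h3 : ((X ^ N : ℕ) : ℝ) ≤ ((2 * (X - 1) ^ N : ℕ) : ℝ) := by
    push_cast [Nat.cast_sub (show 1 ≤ X from hX)]
    have e : ((X : ℝ) - 1) = X * (1 + -1 / X) := by field_simp; ring
    rw [e, mul_pow]
    have : (0 : ℝ) < (X : ℝ) ^ N := by positivity
    nlinarith [h1, h2]
  exact_mod_cast h3

/-- A random monic polynomial of degree `N` whose coefficients are random `2 * N`-bit numbers is
irreducible modulo a small prime with noticeable probability. -/
theorem card_irreducible_of_bits (p N : ℕ) [hp : Fact p.Prime] (hN : 4 ≤ N) (hpN : p ≤ 2 ^ N)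
    [DecidablePred fun H : Fin N → Fin (2 ^ (2 * N)) =>
      Irreducible (monicOf fun j => ((H j : ℕ) : ZMod p))] :
    Fintype.card (Fin N → Fin (2 ^ (2 * N))) ≤
      4 * N * (Finset.univ.filter fun H : Fin N → Fin (2 ^ (2 * N)) =>
        Irreducible (monicOf fun j => ((H j : ℕ) : ZMod p))).card := by
  classical
  set Q := 2 ^ (2 * N) / p with hQ
  have hp0 := hp.out.pos
  have hpQ : p * Q ≤ 2 ^ (2 * N) := Nat.mul_div_le _ _
  have hpQ' : 2 ^ (2 * N) < p * Q + p := by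
    have := Nat.lt_mul_div_succ (2 ^ (2 * N)) hp0
    rwa [mul_add, mul_one] at this
  set I := Finset.univ.filter fun H : Fin N → ZMod p => Irreducible (monicOf H) with hI
  set J := Finset.univ.filter fun H : Fin N → Fin (2 ^ (2 * N)) =>
        Irreducible (monicOf fun j => ((H j : ℕ) : ZMod p)) with hJ
  have hcardI := card_irreducible_monicOf p N hN
  have hlt : ∀ (z : ZMod p) (i : Fin Q), z.val + p * i < 2 ^ (2 * N) := fun z i =>
    calc z.val + p * i < p + p * i := Nat.add_lt_add_right (ZMod.val_lt z) _
      _ = p * (i + 1) := by ring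
      _ ≤ p * Q := Nat.mul_le_mul_left _ i.2
      _ ≤ _ := hpQ
  -- Each residue modulo p has at least Q representatives of 2N bits. Rounding 2^(2N) down to p * Q
  -- costs at most a factor 2 over all N coordinates, since p ≤ 2^N.
  have hle : I.card * Q ^ N ≤ J.card := by
    have := Finset.card_le_card_of_injOn (s := I ×ˢ (Finset.univ : Finset (Fin N → Fin Q))) (t := J)
      (fun z j => ⟨(z.1 j).val + p * z.2 j, hlt _ _⟩) (fun z hz => by
        simp only [hI, Finset.coe_product, Set.mem_prod, Finset.mem_coe, Finset.mem_filter,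
          Finset.mem_univ, true_and, and_true] at hz
        simpa [hJ] using hz) (by
        rintro ⟨h, i⟩ - ⟨h', i'⟩ - heq
        have h1 : ∀ j, (h j).val + p * i j = (h' j).val + p * i' j := fun j =>
          congrArg Fin.val (congrFun heq j)
        have h2 : ∀ j, h j = h' j := fun j => by
          have := congrArg (fun x : ℕ => (x : ZMod p)) (h1 j)
          simpa using this
        have h3 : ∀ j, i j = i' j := fun j => by
          have := h1 j
          rw [h2 j] at this
          exact Fin.ext (Nat.eq_of_mul_eq_mul_left hp0 (Nat.add_left_cancel this))
        rw [funext h2, funext h3])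
    simpa using this
  have hX : 0 < 2 ^ N := by positivity
  have h1 : 2 ^ N * (2 ^ N - 1) ≤ p * Q := by
    rw [two_mul, pow_add] at hpQ'
    rw [Nat.mul_sub, mul_one]
    omega
  calc Fintype.card (Fin N → Fin (2 ^ (2 * N))) = (2 ^ N) ^ N * (2 ^ N) ^ N := by
        simp [two_mul, pow_add, mul_pow]
    _ ≤ (2 ^ N) ^ N * (2 * (2 ^ N - 1) ^ N) :=
        Nat.mul_le_mul_left _ (pow_le_two_mul_sub_one_pow hX (two_mul_le_two_pow (by omega)))
    _ = 2 * (2 ^ N * (2 ^ N - 1)) ^ N := by rw [mul_pow]; ring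
    _ ≤ 2 * (p * Q) ^ N := Nat.mul_le_mul_left _ (Nat.pow_le_pow_left h1 N)
    _ = 2 * (p ^ N * Q ^ N) := by rw [mul_pow]
    _ ≤ 2 * (2 * N * I.card * Q ^ N) := by gcongr
    _ = 4 * N * (I.card * Q ^ N) := by ring
    _ ≤ 4 * N * J.card := by gcongr

variable {F : Type u} [Field F]

theorem exists_root_monicOf {K : Type*} [Field K] [IsAlgClosed K] {N : ℕ} (hN : 0 < N)
    (H : Fin N → K) : ∃ θ : K, θ ^ N + ∑ j : Fin N, H j * θ ^ (j : ℕ) = 0 := by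
  obtain ⟨θ, hθ⟩ := IsAlgClosed.exists_root (monicOf H) (by
    rw [degree_eq_natDegree (monicOf_monic H).ne_zero, natDegree_monicOf]
    exact_mod_cast hN.ne')
  exact ⟨θ, by simpa [monicOf, IsRoot, eval_finsetSum] using hθ⟩

open Classical in
/-- Random moduli that provide an extension in which the values of random polynomials are spread
are frequent. -/
theorem exists_good_moduli (F : Type u) [Field F] {N : ℕ} (hN : 4 ≤ N) :
    ∃ G : Finset (Fin N → Fin (2 ^ (2 * N))),
      Fintype.card (Fin N → Fin (2 ^ (2 * N))) ≤ 4 * N * G.card ∧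
      ∀ H ∈ G, ∃ θ : AlgebraicClosure F,
        θ ^ N + ∑ j : Fin N, ((H j : ℕ) : AlgebraicClosure F) * θ ^ (j : ℕ) = 0 ∧
        ∀ e, 2 ^ N * (Finset.univ.filter fun x : Fin N → Fin (2 ^ (2 * N)) =>
          ∑ j, ((x j : ℕ) : AlgebraicClosure F) * θ ^ (j : ℕ) = e).card ≤
            Fintype.card (Fin N → Fin (2 ^ (2 * N))) := by
  obtain ⟨p, hp⟩ := CharP.exists (AlgebraicClosure F)
  -- In the first case every modulus is good, in the second the irreducible ones are.
  by_cases hlarge : p = 0 ∨ 2 ^ N ≤ p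
  · refine ⟨Finset.univ, ?_, fun H _ => ?_⟩
    · rw [Finset.card_univ]
      exact Nat.le_mul_of_pos_left _ (by omega)
    · obtain ⟨θ, hθ⟩ := exists_root_monicOf (by omega) fun j => ((H j : ℕ) : AlgebraicClosure F)
      exact ⟨θ, hθ, fun e => card_fiber_of_large_char p (by omega) (by omega) hlarge θ e⟩
  · push Not at hlarge
    have hprime : Fact p.Prime := ⟨(CharP.char_is_prime_or_zero (AlgebraicClosure F) p).resolve_right
      hlarge.1⟩
    refine ⟨_, card_irreducible_of_bits p N hN hlarge.2.le, fun H hH => ?_⟩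
    simp only [Finset.mem_filter, Finset.mem_univ, true_and] at hH
    obtain ⟨θ, hθ⟩ := exists_root_monicOf (by omega) fun j => ((H j : ℕ) : AlgebraicClosure F)
    exact ⟨θ, hθ, fun e => card_fiber_of_irreducible p (by omega) (fun j => H j) θ e hH hθ⟩

open Classical in
/-- Random coefficients produce a nonzero value of a nonzero polynomial with noticeable
probability. -/
theorem card_good_coefficients {σ : Type*} [Fintype σ] [DecidableEq σ] {N : ℕ} (hN : 4 ≤ N)
    (P : MvPolynomial σ F) (hP : P ≠ 0) (hdeg : 2 * P.totalDegree ≤ 2 ^ N) :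
    Fintype.card ((Fin N → Fin (2 ^ (2 * N))) × (σ → Fin N → Fin (2 ^ (2 * N)))) ≤
      8 * N * (Finset.univ.filter fun
        z : (Fin N → Fin (2 ^ (2 * N))) × (σ → Fin N → Fin (2 ^ (2 * N))) =>
        ∃ θ : AlgebraicClosure F,
          θ ^ N + ∑ j : Fin N, ((z.1 j : ℕ) : AlgebraicClosure F) * θ ^ (j : ℕ) = 0 ∧
          MvPolynomial.aeval (fun i => ∑ j : Fin N,
            ((z.2 i j : ℕ) : AlgebraicClosure F) * θ ^ (j : ℕ)) P ≠ 0).card := by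
  set Ω := Fin N → Fin (2 ^ (2 * N)) with hΩ
  obtain ⟨G, hG, hG'⟩ := exists_good_moduli F hN
  set K := AlgebraicClosure F
  have hP' : MvPolynomial.map (algebraMap F K) P ≠ 0 := by
    rwa [Ne, map_eq_zero_iff _ (MvPolynomial.map_injective _ (algebraMap F K).injective)]
  set T := Finset.univ.filter fun z : Ω × (σ → Ω) => ∃ θ : K,
          θ ^ N + ∑ j : Fin N, ((z.1 j : ℕ) : K) * θ ^ (j : ℕ) = 0 ∧
          MvPolynomial.aeval (fun i => ∑ j : Fin N, ((z.2 i j : ℕ) : K) * θ ^ (j : ℕ)) P ≠ 0 with hT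
  -- For a good modulus Schwartz–Zippel bounds the failure probability by deg P / 2^N ≤ 1/2.
  -- Together with the 1/(4N) for the modulus this gives 1/(8N).
  have hfib : ∀ H ∈ G, Fintype.card (σ → Ω) ≤
      2 * (Finset.univ.filter fun w : σ → Ω => (H, w) ∈ T).card := by
    intro H hH
    obtain ⟨θ, hθ, hfib⟩ := hG' H hH
    set B := Finset.univ.filter fun w : σ → Ω => MvPolynomial.eval
      (fun i => ∑ j : Fin N, ((w i j : ℕ) : K) * θ ^ (j : ℕ)) (MvPolynomial.map (algebraMap F K) P) = 0
      with hB
    have h1 : 2 ^ N * B.card ≤ _ := MvPolynomial.card_zeros_mul_le_of_card_fiber'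
      (fun x : Ω => ∑ j : Fin N, ((x j : ℕ) : K) * θ ^ (j : ℕ)) (2 ^ N) hfib _ hP'
    have hcard : Fintype.card (σ → Ω) = Fintype.card Ω ^ Fintype.card σ := by
      rw [Fintype.card_fun]
    rw [← hcard] at h1
    have h2 : 2 * B.card ≤ Fintype.card (σ → Ω) := by
      have h3 : 2 * (MvPolynomial.map (algebraMap F K) P).totalDegree ≤ 2 ^ N :=
        le_trans (Nat.mul_le_mul_left 2 (Finset.sup_mono (MvPolynomial.support_map_subset _ _))) hdeg
      have h4 : 2 ^ N * (2 * B.card) ≤ 2 ^ N * Fintype.card (σ → Ω) :=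
        calc 2 ^ N * (2 * B.card) = 2 * (2 ^ N * B.card) := by ring
          _ ≤ 2 * ((MvPolynomial.map (algebraMap F K) P).totalDegree * Fintype.card (σ → Ω)) :=
            Nat.mul_le_mul_left 2 h1
          _ = (2 * (MvPolynomial.map (algebraMap F K) P).totalDegree) * Fintype.card (σ → Ω) := by
            ring
          _ ≤ _ := Nat.mul_le_mul_right _ h3
      exact Nat.le_of_mul_le_mul_left h4 (by positivity)
    have h5 : Bᶜ ⊆ Finset.univ.filter fun w : σ → Ω => (H, w) ∈ T := by
      intro w hw
      simp only [hB, Finset.mem_compl, Finset.mem_filter, Finset.mem_univ, true_and] at hw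
      simp only [hT, Finset.mem_filter, Finset.mem_univ, true_and]
      refine ⟨θ, hθ, ?_⟩
      rwa [MvPolynomial.eval_map, ← MvPolynomial.aeval_def] at hw
    have h6 := Finset.card_le_card h5
    rw [Finset.card_compl] at h6
    omega
  have hsum : ∑ H ∈ G, (Finset.univ.filter fun w : σ → Ω => (H, w) ∈ T).card ≤ T.card := by
    rw [← Finset.card_sigma]
    refine Finset.card_le_card_of_injOn (fun z => (z.1, z.2)) (fun z hz => ?_) ?_
    · simpa using (Finset.mem_sigma.1 hz).2
    · rintro ⟨a, b⟩ - ⟨c, d⟩ - h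
      simpa using h
  rw [Fintype.card_prod]
  calc Fintype.card Ω * Fintype.card (σ → Ω)
      ≤ 4 * N * G.card * Fintype.card (σ → Ω) := Nat.mul_le_mul_right _ hG
    _ = 4 * N * ∑ H ∈ G, Fintype.card (σ → Ω) := by rw [Finset.sum_const, smul_eq_mul]; ring
    _ ≤ 4 * N * ∑ H ∈ G, 2 * (Finset.univ.filter fun w : σ → Ω => (H, w) ∈ T).card :=
        Nat.mul_le_mul_left _ (Finset.sum_le_sum hfib)
    _ = 8 * N * ∑ H ∈ G, (Finset.univ.filter fun w : σ → Ω => (H, w) ∈ T).card := by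
        rw [← Finset.mul_sum]; ring
    _ ≤ 8 * N * T.card := Nat.mul_le_mul_left _ hsum

end Counting

/-! ### Random bits and the coefficients read from them. -/

section Bits

/-- The number whose binary digits are the `m` bits from position `s` on. -/
def bitsVal (ω : ℕ → Bool) (s : ℕ) : ℕ → ℕ
  | 0 => 0
  | m + 1 => bitsVal ω s m + bitsVal ω s m + (ω (s + m)).toNat

theorem bitsVal_lt (ω : ℕ → Bool) (s m : ℕ) : bitsVal ω s m < 2 ^ m := by
  induction m with
  | zero => simp [bitsVal]
  | succ m ih =>
    have := (ω (s + m)).toNat_lt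
    rw [bitsVal, pow_succ]
    omega

theorem bitsVal_shift (ω : ℕ → Bool) (c s m : ℕ) :
    bitsVal (fun i => ω (c + i)) s m = bitsVal ω (c + s) m := by
  induction m with
  | zero => rfl
  | succ m ih => rw [bitsVal, bitsVal, ih, add_assoc c]

theorem bitsVal_congr {ω ω' : ℕ → Bool} {s m : ℕ} (h : ∀ l < m, ω (s + l) = ω' (s + l)) :
    bitsVal ω s m = bitsVal ω' s m := by
  induction m with
  | zero => rfl
  | succ m ih => rw [bitsVal, bitsVal, ih fun l hl => h l (by omega), h m (by omega)]

theorem eq_of_bitsVal_eq {ω ω' : ℕ → Bool} {s m : ℕ} (h : bitsVal ω s m = bitsVal ω' s m) :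
    ∀ l < m, ω (s + l) = ω' (s + l) := by
  induction m with
  | zero => intro l hl; omega
  | succ m ih =>
    rw [bitsVal, bitsVal] at h
    have h1 := (ω (s + m)).toNat_lt
    have h2 := (ω' (s + m)).toNat_lt
    intro l hl
    rcases Nat.lt_succ_iff_lt_or_eq.1 hl with hl | rfl
    · exact ih (by omega) l hl
    · exact (by decide : ∀ a b : Bool, a.toNat = b.toNat → a = b) _ _ (by omega)

/-- A finite bit string, continued by `false`s. -/
def extendBits {T : ℕ} (u : Fin T → Bool) : ℕ → Bool :=
  fun i => if h : i < T then u ⟨i, h⟩ else false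

theorem extendBits_of_lt {T : ℕ} (u : Fin T → Bool) {i : ℕ} (h : i < T) :
    extendBits u i = u ⟨i, h⟩ := dif_pos h

/-- The number of random bits consumed by one round. -/
def roundCoins (n N : ℕ) : ℕ := 2 * N * (N + n * N * (N * N))

/-- The numbers drawn in a round from the bit stream `u`. -/
def drawn (N : ℕ) (u : ℕ → Bool) (x : ℕ) : ℕ := bitsVal u (2 * N * x) (2 * N)

theorem exists_cell_index {n N q : ℕ} (h : q < n * N * (N * N)) :
    ∃ k < n, ∃ a < N, ∃ b < N, ∃ j < N, q = (k * N + a) * (N * N) + (b * N + j) := by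
  have hN : 0 < N := by
    rcases Nat.eq_zero_or_pos N with rfl | h1
    · simp at h
    · exact h1
  have h1 : q / (N * N) < n * N := Nat.div_lt_of_lt_mul (by rwa [mul_comm])
  have h2 : q % (N * N) < N * N := Nat.mod_lt _ (by positivity)
  refine ⟨q / (N * N) / N, Nat.div_lt_of_lt_mul (by rwa [mul_comm N n]), q / (N * N) % N,
    Nat.mod_lt _ hN, q % (N * N) / N, Nat.div_lt_of_lt_mul h2, q % (N * N) % N,
    Nat.mod_lt _ hN, ?_⟩
  rw [Nat.div_add_mod', Nat.div_add_mod', Nat.div_add_mod']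

/-- The coefficients drawn in a round. -/
def drawnCoefficients (n N : ℕ) (u : ℕ → Bool) :
    (Fin N → Fin (2 ^ (2 * N))) × (Fin n × Fin N × Fin N → Fin N → Fin (2 ^ (2 * N))) :=
  (fun j => ⟨drawn N u j, bitsVal_lt _ _ _⟩, fun z j =>
    ⟨drawn N u (N + ((z.1 * N + z.2.1) * (N * N) + (z.2.2 * N + j))), bitsVal_lt _ _ _⟩)

/-- Uniform bits therefore give uniform independent coefficients, so the counts of coefficients
become counts of bit strings. -/
theorem bijective_drawnCoefficients (n N : ℕ) :
    Function.Bijective fun u : Fin (roundCoins n N) → Bool =>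
      drawnCoefficients n N (extendBits u) := by
  rw [Fintype.bijective_iff_injective_and_card]
  constructor
  · intro u u' h
    have hval : ∀ x < N + n * N * (N * N), drawn N (extendBits u) x = drawn N (extendBits u') x := by
      intro x hx
      rcases lt_or_ge x N with h1 | h1
      · exact congrArg Fin.val (congrFun (congrArg Prod.fst h) ⟨x, h1⟩)
      · obtain ⟨k, hk, a, ha, b, hb, j, hj, hq⟩ :=
          exists_cell_index (n := n) (N := N) (q := x - N) (by omega)
        have := congrArg Fin.val (congrFun (congrFun (congrArg Prod.snd h)
          (⟨k, hk⟩, ⟨a, ha⟩, ⟨b, hb⟩)) ⟨j, hj⟩)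
        simp only [drawnCoefficients, ← hq] at this
        rwa [Nat.add_sub_cancel' h1] at this
    funext ⟨i, hi⟩
    have hi' : i < 2 * N * (N + n * N * (N * N)) := hi
    have hm : 0 < 2 * N := Nat.pos_of_ne_zero fun h0 => by simp [h0] at hi'
    have h1 := eq_of_bitsVal_eq (hval (i / (2 * N)) (Nat.div_lt_of_lt_mul hi')) (i % (2 * N))
      (Nat.mod_lt _ hm)
    rwa [Nat.div_add_mod, extendBits_of_lt u hi, extendBits_of_lt u' hi] at h1
  · simp only [Fintype.card_prod, Fintype.card_fun, Fintype.card_fin, Fintype.card_bool]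
    rw [roundCoins, ← pow_mul, ← pow_mul, ← pow_add]
    congr 1
    ring

end Bits

/-! ### Success probability of one round and independent repetition. -/

section Round

variable {F : Type u} [Field F] {n : ℕ}

/-- The random bits `u` make a round detect that the black box `B` is nonzero. -/
def RoundDetects (N : ℕ)
    (B : (d : ℕ) → (Fin n → Matrix (Fin d) (Fin d) F) → Matrix (Fin d) (Fin d) F)
    (u : ℕ → Bool) : Prop :=
  ∀ e : ℕ → ℕ → F, IsBlockArray n N (drawn N u) e → B (N * N) (arrayMatrices n N e) ≠ 0

open Classical in
-- The size bound serves twice: N is at least the number of products, so generic matrices of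
-- dimension N suffice, and 2^N is at least twice the degree of their entries, as Schwartz–Zippel
-- requires.
theorem card_roundDetects {C : NCCircuit F n} (hC : C.IsHomogeneousSigmaPiStarSigma)
    (h0 : C.poly ≠ 0) {N : ℕ} (hN : 4 ≤ N) (hsize : C.size + 1 ≤ N) :
    2 ^ roundCoins n N ≤ 8 * N * (Finset.univ.filter fun u : Fin (roundCoins n N) → Bool =>
      RoundDetects N C.blackBox (extendBits u)).card := by
  obtain ⟨k, D, c, L, hk, hD, hL, hval⟩ := hC.exists_formSum
  have hgen : formSum Finset.univ c L (genericMatrices F n N) ≠ 0 :=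
    formSum_generic_ne_zero D N _ c L (fun i _ => hL i) (by simp; omega) (by
      rw [← hval]; exact h0)
  obtain ⟨a, b, hab⟩ : ∃ a b, formSum Finset.univ c L (genericMatrices F n N) a b ≠ 0 := by
    by_contra! h
    exact hgen (by ext1 a b; simp [h])
  have hdeg := totalDegree_formSum_le (N := N) Finset.univ c L (fun i _ => (hL i).le) a b
  have hcard := card_good_coefficients hN _ hab (by
    calc _ ≤ 2 * 2 ^ C.size := Nat.mul_le_mul_left 2 (hdeg.trans hD)
      _ = 2 ^ (C.size + 1) := by ring
      _ ≤ 2 ^ N := Nat.pow_le_pow_right two_pos hsize)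
  have hbij := bijective_drawnCoefficients n N
  rw [← Fintype.card_of_bijective hbij] at hcard
  simp only [Fintype.card_fun, Fintype.card_fin, Fintype.card_bool] at hcard
  refine hcard.trans (Nat.mul_le_mul_left _ ?_)
  refine Finset.card_le_card_of_surjOn
    (fun u => drawnCoefficients n N (extendBits u)) fun z hz => ?_
  obtain ⟨u, rfl⟩ := hbij.2 z
  refine ⟨u, ?_, rfl⟩
  simp only [Finset.coe_filter, Finset.mem_univ, true_and, Set.mem_ofPred_eq] at hz ⊢
  obtain ⟨θ, hθ, hne⟩ := hz
  intro e he hB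
  apply hne
  rw [NCCircuit.blackBox, hval] at hB
  have h1 := formSum_eigen_eq_zero (by omega) he θ (by
    rw [Finset.sum_range]; exact hθ) Finset.univ c L hB
  rw [formSum_matrix_eq_map] at h1
  have h2 := congrFun (congrFun h1 a) b
  simp only [Matrix.map_apply, Matrix.of_apply, Finset.sum_range, Matrix.zero_apply] at h2
  exact h2

open Classical in
/-- Independent repetition: if each of `R` blocks of `b` bits is in `G` with probability at least
`1 / q`, then all of them miss `G` with probability at most `(1 - 1 / q) ^ R`. -/
theorem card_all_miss_le (b R T q : ℕ) (hT : R * b ≤ T) (G : (ℕ → Bool) → Prop)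
    (hloc : ∀ u u' : ℕ → Bool, (∀ i < b, u i = u' i) → (G u ↔ G u'))
    (hG : 2 ^ b ≤ q * (Finset.univ.filter fun u : Fin b → Bool => G (extendBits u)).card) :
    q ^ R * (Finset.univ.filter fun w : Fin T → Bool =>
      ∀ r < R, ¬ G fun i => extendBits w (r * b + i)).card ≤ (q - 1) ^ R * 2 ^ T := by
  set B := Finset.univ.filter fun u : Fin b → Bool => ¬ G (extendBits u) with hB
  have hBcard : q * B.card ≤ (q - 1) * 2 ^ b := by
    have h1 := Finset.card_filter_add_card_filter_not (s := (Finset.univ : Finset (Fin b → Bool)))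
      (fun u => G (extendBits u))
    simp only [Finset.card_univ, Fintype.card_fun, Fintype.card_fin, Fintype.card_bool] at h1
    have h2 : q * 2 ^ b = q * (Finset.univ.filter fun u : Fin b → Bool =>
        G (extendBits u)).card + q * B.card := by rw [← h1, mul_add]
    rw [Nat.sub_mul, one_mul]
    omega
  -- Cut the string into R blocks of b bits and a tail of T - R * b unused bits; all blocks of a
  -- missing string lie in B.
  have hmap : (Finset.univ.filter fun w : Fin T → Bool =>
      ∀ r < R, ¬ G fun i => extendBits w (r * b + i)).card ≤
      (Fintype.piFinset (fun _ : Fin R => B) ×ˢ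
        (Finset.univ : Finset (Fin (T - R * b) → Bool))).card := by
    refine Finset.card_le_card_of_injOn (fun w => (fun r i => extendBits w (r * b + i),
      fun i => extendBits w (R * b + i))) (fun w hw => ?_) ?_
    · simp only [Finset.coe_filter, Finset.mem_univ, true_and, Set.mem_ofPred_eq] at hw
      simp only [Finset.coe_product, Set.mem_prod, Finset.mem_coe, Fintype.mem_piFinset,
        Finset.mem_univ, and_true]
      intro r
      simp only [hB, Finset.mem_filter, Finset.mem_univ, true_and]
      intro hg
      refine hw r r.2 ((hloc _ _ fun i hi => ?_).1 hg)
      rw [extendBits_of_lt _ hi]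
    · rintro w - w' - h
      have h1 := congrArg Prod.fst h
      have h2 := congrArg Prod.snd h
      funext ⟨i, hi⟩
      rw [← extendBits_of_lt w hi, ← extendBits_of_lt w' hi]
      rcases lt_or_ge i (R * b) with hlt | hge
      · have hb : 0 < b := Nat.pos_of_ne_zero fun h0 => by simp [h0] at hlt
        have := congrFun (congrFun h1 ⟨i / b, Nat.div_lt_of_lt_mul (by rwa [mul_comm])⟩)
          ⟨i % b, Nat.mod_lt _ hb⟩
        simpa only [Nat.div_add_mod'] using this
      · have := congrFun h2 ⟨i - R * b, by omega⟩
        simpa only [Nat.add_sub_cancel' hge] using this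
  calc _ ≤ q ^ R * (B.card ^ R * 2 ^ (T - R * b)) := by
        refine Nat.mul_le_mul_left _ (hmap.trans (le_of_eq ?_))
        simp [Fintype.card_piFinset]
    _ = (q * B.card) ^ R * 2 ^ (T - R * b) := by rw [mul_pow, mul_assoc]
    _ ≤ ((q - 1) * 2 ^ b) ^ R * 2 ^ (T - R * b) := by gcongr
    _ = (q - 1) ^ R * (2 ^ (R * b) * 2 ^ (T - R * b)) := by
        rw [mul_pow, ← pow_mul, mul_comm b R, mul_assoc]
    _ = (q - 1) ^ R * 2 ^ T := by rw [← pow_add, Nat.add_sub_cancel' hT]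

/-- This locality is what makes rounds on disjoint blocks of bits independent. -/
theorem RoundDetects.congr {N : ℕ}
    (B : (d : ℕ) → (Fin n → Matrix (Fin d) (Fin d) F) → Matrix (Fin d) (Fin d) F)
    (u u' : ℕ → Bool) (h : ∀ i < roundCoins n N, u i = u' i) :
    RoundDetects N B u ↔ RoundDetects N B u' := by
  have key : ∀ x < N + n * N * (N * N), drawn N u x = drawn N u' x := fun x hx =>
    bitsVal_congr fun l hl => h _ (by
      calc 2 * N * x + l < 2 * N * x + 2 * N := by omega
        _ = 2 * N * (x + 1) := by ring
        _ ≤ 2 * N * (N + n * N * (N * N)) := Nat.mul_le_mul_left _ hx)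
  have key2 : ∀ e : ℕ → ℕ → F, ∀ v v' : ℕ → ℕ, (∀ x < N + n * N * (N * N), v x = v' x) →
      IsBlockArray n N v e → IsBlockArray n N v' e := fun e v v' hv he =>
    ⟨fun g hg c hc => by
      rw [he.first g hg c hc, hv]
      have : (g + 1) * (N * N) ≤ n * N * (N * N) := Nat.mul_le_mul_right _ hg
      rw [add_mul, one_mul] at this
      omega, fun g hg α hα b hb β hβ => by
      rw [he.step g hg α hα b hb β hβ, hv β (by omega)]⟩
  exact ⟨fun hd e he => hd e (key2 e _ _ (fun x hx => (key x hx).symm) he),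
    fun hd e he => hd e (key2 e _ _ key he)⟩

end Round

/-! ### The program: random cells and rows of multiplication matrices. -/

section Machine

namespace BBProg

/-- The registers a program may change. -/
def writes : BBProg → List ℕ
  | .zero a | .succ a _ | .add a _ _ | .sub a _ _ | .flip a => [a]
  | .fzero _ | .fone _ | .fcopy _ _ | .fadd _ _ _ | .fsub _ _ _ | .fmul _ _ _ | .finv _ _
  | .query _ _ _ => []
  | .seq p q | .ifZero _ p q | .ifFZero _ p q => p.writes ++ q.writes
  | .loop _ p => p.writes

variable {F : Type u} [Field F] {n : ℕ}
  (B : (d : ℕ) → (Fin n → Matrix (Fin d) (Fin d) F) → Matrix (Fin d) (Fin d) F) (ω : ℕ → Bool)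

/-- The syntactic frame rule: since `writes` is computable, that a concrete program preserves a
register is settled by `decide`. -/
theorem run_reg_of_notMem_writes (p : BBProg) (σ : BBState F) (x : ℕ) (hx : x ∉ p.writes) :
    (p.run B ω σ).reg x = σ.reg x := by
  induction p generalizing σ with
  | zero a => exact Function.update_of_ne (by simpa [writes] using hx) _ _
  | succ a b => exact Function.update_of_ne (by simpa [writes] using hx) _ _
  | add a b c => exact Function.update_of_ne (by simpa [writes] using hx) _ _
  | sub a b c => exact Function.update_of_ne (by simpa [writes] using hx) _ _
  | flip a => exact Function.update_of_ne (by simpa [writes] using hx) _ _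
  | fzero _ | fone _ | fcopy _ _ | fadd _ _ _ | fsub _ _ _ | fmul _ _ _ | finv _ _
  | query _ _ _ => rfl
  | seq p q ihp ihq =>
    simp only [writes, List.mem_append, not_or] at hx
    rw [run, ihq _ hx.2, ihp _ hx.1]
  | ifZero a p q ihp ihq =>
    simp only [writes, List.mem_append, not_or] at hx
    rw [run]
    split_ifs
    · exact ihp _ hx.1
    · exact ihq _ hx.2
  | ifFZero a p q ihp ihq =>
    simp only [writes, List.mem_append, not_or] at hx
    rw [run]
    split_ifs
    · exact ihp _ hx.1
    · exact ihq _ hx.2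
  | loop a p ih =>
    rw [run]
    have : ∀ k (τ : BBState F), ((fun τ => p.run B ω (τ.tick 1))^[k] τ).reg x = τ.reg x := by
      intro k
      induction k with
      | zero => intro τ; rfl
      | succ k ihk => intro τ; rw [Function.iterate_succ_apply, ihk]; exact ih _ hx
    exact this _ _

theorem run_seq (p q : BBProg) (σ : BBState F) :
    (BBProg.seq p q).run B ω σ = q.run B ω (p.run B ω σ) := rfl

/-- Loop invariants. -/
theorem run_loop_induction {a : ℕ} {p : BBProg} {σ : BBState F} (I : ℕ → BBState F → Prop)
    (h0 : I 0 (σ.tick 1))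
    (hs : ∀ i < σ.reg a, ∀ τ, (∀ x ∉ p.writes, τ.reg x = σ.reg x) → I i τ →
      I (i + 1) (p.run B ω (τ.tick 1))) :
    I (σ.reg a) ((BBProg.loop a p).run B ω σ) := by
  rw [run]
  have : ∀ k ≤ σ.reg a,
      (∀ x ∉ p.writes, ((fun τ => p.run B ω (τ.tick 1))^[k] (σ.tick 1)).reg x = σ.reg x) ∧
      I k ((fun τ => p.run B ω (τ.tick 1))^[k] (σ.tick 1)) := by
    intro k hk
    induction k with
    | zero => exact ⟨fun x _ => rfl, h0⟩
    | succ k ih =>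
      obtain ⟨h1, h2⟩ := ih (by omega)
      rw [Function.iterate_succ_apply']
      exact ⟨fun x hx => (run_reg_of_notMem_writes B ω p _ x hx).trans (h1 x hx),
        hs k (by omega) _ h1 h2⟩
  exact (this _ le_rfl).2

/-- Store a random number at `[13]` and increment register `13`. -/
def randCell : BBProg :=
  .seq (.fzero 13) <| .seq
    (.loop 7 <| .seq (.fadd 13 13 13) <| .seq (.flip 16) (.ifZero 16 (.zero 17) (.fadd 13 13 9)))
    (.succ 13 13)

/-- Horner's rule in base 2 takes place in the field, so only the image of the number in F is ever
formed. The idle instruction in the zero branch makes the running time independent of the bits. In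
the whole program cell 0 holds 0, cell 1 holds 1, cell 2 is scratch, the modulus starts at cell 3
and the matrices at cell 3 + N; register 13 is the write pointer. -/
theorem run_randCell (σ : BBState F) {m : ℕ} (h7 : σ.reg 7 = m) (h9 : σ.reg 9 = 1)
    (h1 : σ.mem 1 = 1) (h13 : 2 ≤ σ.reg 13) :
    (randCell.run B ω σ).reg 13 = σ.reg 13 + 1 ∧
    (randCell.run B ω σ).mem = Function.update σ.mem (σ.reg 13) (bitsVal ω σ.coins m : F) ∧
    (randCell.run B ω σ).coins = σ.coins + m ∧
    (randCell.run B ω σ).time = σ.time + (5 * m + 3) := by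
  have key := run_loop_induction B ω (a := 7)
    (p := .seq (.fadd 13 13 13) <| .seq (.flip 16) (.ifZero 16 (.zero 17) (.fadd 13 13 9)))
    (σ := σ.setMem 13 0)
    (fun i τ => τ.reg 13 = σ.reg 13 ∧
      τ.mem = Function.update σ.mem (σ.reg 13) (bitsVal ω σ.coins i : F) ∧
      τ.coins = σ.coins + i ∧ τ.time = σ.time + 2 + 5 * i)
    ⟨rfl, by simp [BBState.tick, BBState.setMem, bitsVal], rfl, rfl⟩ (by
      rintro i - τ hτ ⟨hp, hm, hc, ht⟩
      have h9' : τ.reg 9 = 1 := (hτ 9 (by decide)).trans h9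
      have hne : (1 : ℕ) ≠ σ.reg 13 := by omega
      simp only [run, BBState.setReg, BBState.setMem, BBState.get, BBState.tick, hp, hm, hc, ht]
      cases hb : ω (σ.coins + i)
      · simp [bitsVal, hb, hp]
        omega
      · simp [bitsVal, hb, hp, hne, h1, h9']
        omega)
  have h7' : (σ.setMem 13 0).reg 7 = m := h7
  rw [h7'] at key
  simp only [randCell]
  rw [run_seq, run_seq]
  obtain ⟨hp, hm, hc, ht⟩ := key
  exact ⟨congrArg (· + 1) hp, hm, hc, (congrArg (· + 1) ht).trans (by ring)⟩

/-- Store random numbers in as many cells as register `a` says, from `[13]` on. -/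
def fillCells (a : ℕ) : BBProg := .loop a randCell

theorem run_fillCells (σ : BBState F) {a m l p : ℕ} (ha : σ.reg a = l) (h7 : σ.reg 7 = m)
    (h9 : σ.reg 9 = 1) (h1 : σ.mem 1 = 1) (hp : σ.reg 13 = p) (hp2 : 2 ≤ p) :
    ((fillCells a).run B ω σ).reg 13 = p + l ∧
    (∀ c < l, ((fillCells a).run B ω σ).mem (p + c) = (bitsVal ω (σ.coins + m * c) m : F)) ∧
    (∀ x, x < p ∨ p + l ≤ x → ((fillCells a).run B ω σ).mem x = σ.mem x) ∧
    ((fillCells a).run B ω σ).coins = σ.coins + m * l ∧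
    ((fillCells a).run B ω σ).time = σ.time + 1 + l * (5 * m + 4) := by
  have key := run_loop_induction B ω (a := a) (p := randCell) (σ := σ)
    (fun i τ => τ.reg 13 = p + i ∧
      (∀ c < i, τ.mem (p + c) = (bitsVal ω (σ.coins + m * c) m : F)) ∧
      (∀ x, x < p ∨ p + i ≤ x → τ.mem x = σ.mem x) ∧
      τ.coins = σ.coins + m * i ∧ τ.time = σ.time + 1 + i * (5 * m + 4))
    ⟨hp, by simp, fun _ _ => rfl, rfl, by simp [BBState.tick]⟩ (by
      rintro i - τ hτ ⟨hp', hm, hm', hc, ht⟩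
      obtain ⟨r1, r2, r3, r4⟩ := run_randCell B ω (τ.tick 1) ((hτ 7 (by decide)).trans h7)
        ((hτ 9 (by decide)).trans h9) ((hm' 1 (by omega)).trans h1)
        (show 2 ≤ τ.reg 13 by omega)
      have hq : (τ.tick 1).reg 13 = p + i := hp'
      have hc' : (τ.tick 1).coins = σ.coins + m * i := hc
      have ht' : (τ.tick 1).time = τ.time + 1 := rfl
      have hmm : (τ.tick 1).mem = τ.mem := rfl
      rw [hq] at r1 r2
      rw [hc'] at r2 r3
      rw [ht', ht] at r4
      refine ⟨by rw [r1]; ring, fun c hc => ?_, fun x hx => ?_, by rw [r3]; ring, by rw [r4]; ring⟩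
      · rw [r2, hmm]
        rcases Nat.lt_succ_iff_lt_or_eq.1 hc with h | rfl
        · rw [Function.update_of_ne (by omega), hm c h]
        · rw [Function.update_self]
      · rw [r2, hmm, Function.update_of_ne (by omega), hm' x (by omega)])
  rw [ha] at key
  exact key

/-- Store at `[13]` the next row of a block of dimension given by register `3`; register `4` says
how far back the previous row is. -/
def blockStep : BBProg :=
  .seq (.sub 14 13 4) <| .seq (.add 15 14 3) <| .seq (.sub 15 15 9) <| .seq (.zero 18) <|
  .seq (.add 17 10 8) <|
  .loop 3 <| .seq (.fmul 12 15 17) <| .seq (.fsub 13 18 12) <| .seq (.add 18 14 8) <|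
    .seq (.succ 14 14) <| .seq (.succ 13 13) (.succ 17 17)

/-- Multiplication by the variable modulo h. Register 14 runs along the previous row, 15 points to
its last entry, 17 runs along the modulus. Register 18 lags one behind 14 and starts at cell 0,
which supplies the 0 shifted in. -/
theorem run_blockStep (σ : BBState F) {N d q : ℕ} (h3 : σ.reg 3 = N) (h4 : σ.reg 4 = d)
    (h8 : σ.reg 8 = 0) (h9 : σ.reg 9 = 1) (h10 : σ.reg 10 = 3) (h12 : σ.reg 12 = 2)
    (h0 : σ.mem 0 = 0) (h13 : σ.reg 13 = q + d) (hN : 0 < N) (hq : 3 + N ≤ q) (hd : N ≤ d) :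
    (blockStep.run B ω σ).reg 13 = q + d + N ∧
    (∀ β < N, (blockStep.run B ω σ).mem (q + d + β) =
      (if β = 0 then 0 else σ.mem (q + (β - 1))) - σ.mem (q + (N - 1)) * σ.mem (3 + β)) ∧
    (∀ x, x ≠ 2 → x < q + d ∨ q + d + N ≤ x → (blockStep.run B ω σ).mem x = σ.mem x) ∧
    (blockStep.run B ω σ).coins = σ.coins ∧
    (blockStep.run B ω σ).time = σ.time + 6 + 7 * N := by
  rw [blockStep]
  iterate 5 rw [run_seq]
  set body : BBProg := .seq (.fmul 12 15 17) <| .seq (.fsub 13 18 12) <| .seq (.add 18 14 8) <|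
    .seq (.succ 14 14) <| .seq (.succ 13 13) (.succ 17 17) with hbody
  set σ' := BBProg.run B ω (.add 17 10 8) (BBProg.run B ω (.zero 18) (BBProg.run B ω (.sub 15 15 9)
    (BBProg.run B ω (.add 15 14 3) (BBProg.run B ω (.sub 14 13 4) σ)))) with hσ'
  have e13 : σ'.reg 13 = q + d := by simp [hσ', run, BBState.setReg, h13]
  have e14 : σ'.reg 14 = q := by simp [hσ', run, BBState.setReg, h13, h4]
  have e15 : σ'.reg 15 = q + (N - 1) := by
    simp [hσ', run, BBState.setReg, h13, h4, h3, h9]; omega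
  have e17 : σ'.reg 17 = 3 := by simp [hσ', run, BBState.setReg, h10, h8]
  have e18 : σ'.reg 18 = 0 := by simp [hσ', run, BBState.setReg]
  have e3 : σ'.reg 3 = N := by simp [hσ', run, BBState.setReg, h3]
  have e8 : σ'.reg 8 = 0 := by simp [hσ', run, BBState.setReg, h8]
  have e12 : σ'.reg 12 = 2 := by simp [hσ', run, BBState.setReg, h12]
  have em : σ'.mem = σ.mem := rfl
  have ec : σ'.coins = σ.coins := rfl
  have et : σ'.time = σ.time + 5 := rfl
  clear_value σ'
  have key := run_loop_induction B ω (a := 3) (p := body) (σ := σ')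
    (fun i τ => τ.reg 13 = q + d + i ∧ τ.reg 14 = q + i ∧ τ.reg 17 = 3 + i ∧
      τ.reg 18 = (if i = 0 then 0 else q + (i - 1)) ∧
      (∀ β < i, τ.mem (q + d + β) =
        (if β = 0 then 0 else σ.mem (q + (β - 1))) - σ.mem (q + (N - 1)) * σ.mem (3 + β)) ∧
      (∀ x, x ≠ 2 → x < q + d ∨ q + d + i ≤ x → τ.mem x = σ.mem x) ∧
      τ.coins = σ.coins ∧ τ.time = σ.time + 6 + 7 * i)
    ⟨e13, e14, e17, e18, by simp, fun x _ _ => by rw [← em]; rfl, ec, by simp [BBState.tick, et]⟩ (by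
      rintro i hi τ hτ ⟨t13, t14, t17, t18, tm, tm', tc, tt⟩
      rw [e3] at hi
      have t15 : τ.reg 15 = q + (N - 1) := (hτ 15 (by decide)).trans e15
      have t12 : τ.reg 12 = 2 := (hτ 12 (by decide)).trans e12
      have t8 : τ.reg 8 = 0 := (hτ 8 (by decide)).trans e8
      have hmem : ∀ x, x ≠ 2 → (body.run B ω (τ.tick 1)).mem x = if x = q + d + i then
          (if i = 0 then 0 else σ.mem (q + (i - 1))) - σ.mem (q + (N - 1)) * σ.mem (3 + i)
          else τ.mem x := by
        intro x hx
        have m1 : τ.mem (q + (N - 1)) = σ.mem (q + (N - 1)) := tm' _ (by omega) (by omega)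
        have m2 : τ.mem (3 + i) = σ.mem (3 + i) := tm' _ (by omega) (by omega)
        have m3 : τ.mem (if i = 0 then 0 else q + (i - 1)) =
            if i = 0 then 0 else σ.mem (q + (i - 1)) := by
          split_ifs with h
          · rw [tm' 0 (by omega) (by omega), h0]
          · exact tm' _ (by omega) (by omega)
        have n1 : (if i = 0 then 0 else q + (i - 1)) ≠ 2 := by split_ifs <;> omega
        simp only [hbody, run, BBState.setReg, BBState.setMem, BBState.get, BBState.tick, t12, t13,
          t15, t17, t18, m1, m2, Function.update_self, Function.update_of_ne n1, m3]
        by_cases hx' : x = q + d + i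
        · rw [if_pos hx', hx', Function.update_self]
        · rw [if_neg hx', Function.update_of_ne hx', Function.update_of_ne hx]
      refine ⟨?_, ?_, ?_, ?_, fun β hβ => ?_, fun x hx hx' => ?_, ?_, ?_⟩
      · simp [hbody, run, BBState.setReg, BBState.setMem, BBState.tick, t13]; omega
      · simp [hbody, run, BBState.setReg, BBState.setMem, BBState.tick, t14]; omega
      · simp [hbody, run, BBState.setReg, BBState.setMem, BBState.tick, t17]; omega
      · simp [hbody, run, BBState.setReg, BBState.setMem, BBState.tick, t14, t8]
      · rw [hmem _ (by omega)]
        rcases Nat.lt_succ_iff_lt_or_eq.1 hβ with h | rfl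
        · rw [if_neg (by omega), tm β h]
        · rw [if_pos rfl]
      · rw [hmem _ hx, if_neg (by omega), tm' x hx (by omega)]
      · simp [hbody, run, BBState.setReg, BBState.setMem, BBState.tick, tc]
      · simp [hbody, run, BBState.setReg, BBState.setMem, BBState.tick, tt]; omega)
  rw [e3] at key
  exact ⟨key.1, key.2.2.2.2⟩

end BBProg

end Machine

/-! ### One round of the test. -/

section Machine

/-- The registers and cells that are constant during the rounds. -/
structure BBState.IsReady {F : Type u} [Field F] (n N : ℕ) (σ : BBState F) : Prop where
  r3 : σ.reg 3 = N
  r4 : σ.reg 4 = N * N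
  r5 : σ.reg 5 = n * N
  r6 : σ.reg 6 = N * N - N
  r7 : σ.reg 7 = 2 * N
  r8 : σ.reg 8 = 0
  r9 : σ.reg 9 = 1
  r10 : σ.reg 10 = 3
  r11 : σ.reg 11 = 3 + N
  r12 : σ.reg 12 = 2
  m0 : σ.mem 0 = 0
  m1 : σ.mem 1 = 1

namespace BBProg

variable {F : Type u} [Field F] {n N : ℕ}
  (B : (d : ℕ) → (Fin n → Matrix (Fin d) (Fin d) F) → Matrix (Fin d) (Fin d) F) (ω : ℕ → Bool)

theorem isReady_of_eq {σ τ : BBState F} (h : σ.IsReady n N)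
    (hr : ∀ x, 3 ≤ x → x < 13 → τ.reg x = σ.reg x) (hm : ∀ x < 2, τ.mem x = σ.mem x) :
    τ.IsReady n N where
  r3 := (hr 3 (by decide) (by decide)).trans h.r3
  r4 := (hr 4 (by decide) (by decide)).trans h.r4
  r5 := (hr 5 (by decide) (by decide)).trans h.r5
  r6 := (hr 6 (by decide) (by decide)).trans h.r6
  r7 := (hr 7 (by decide) (by decide)).trans h.r7
  r8 := (hr 8 (by decide) (by decide)).trans h.r8
  r9 := (hr 9 (by decide) (by decide)).trans h.r9
  r10 := (hr 10 (by decide) (by decide)).trans h.r10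
  r11 := (hr 11 (by decide) (by decide)).trans h.r11
  r12 := (hr 12 (by decide) (by decide)).trans h.r12
  m0 := (hm 0 (by decide)).trans h.m0
  m1 := (hm 1 (by decide)).trans h.m1

/-- No register between `3` and `12` is changed. -/
def KeepsConstants (p : BBProg) : Prop := ∀ x ∈ p.writes, x < 3 ∨ 13 ≤ x

instance (p : BBProg) : Decidable p.KeepsConstants :=
  inferInstanceAs (Decidable (∀ x ∈ p.writes, x < 3 ∨ 13 ≤ x))

theorem IsReady.run {p : BBProg} (hp : p.KeepsConstants) {σ : BBState F} (h : σ.IsReady n N)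
    (hm : ∀ x < 2, (p.run B ω σ).mem x = σ.mem x) : (p.run B ω σ).IsReady n N :=
  isReady_of_eq h (fun x h3 h13 => run_reg_of_notMem_writes B ω p σ x fun hx => by
    have := hp x hx
    omega) hm

/-- As many block rows as register `6` says. -/
def stepBlocks : BBProg := .loop 6 blockStep

theorem run_stepBlocks (σ : BBState F) {q : ℕ} (h : σ.IsReady n N) (h13 : σ.reg 13 = q + N * N)
    (hN : 0 < N) (hq : 3 + N ≤ q) :
    (stepBlocks.run B ω σ).reg 13 = q + N * N + (N * N - N) * N ∧
    (∀ i < N * N - N, ∀ β < N, (stepBlocks.run B ω σ).mem (q + N * N + (i * N + β)) =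
      (if β = 0 then 0 else (stepBlocks.run B ω σ).mem (q + (i * N + (β - 1)))) -
        (stepBlocks.run B ω σ).mem (q + (i * N + (N - 1))) *
          (stepBlocks.run B ω σ).mem (3 + β)) ∧
    (∀ x, x ≠ 2 → x < q + N * N ∨ q + N * N + (N * N - N) * N ≤ x →
      (stepBlocks.run B ω σ).mem x = σ.mem x) ∧
    (stepBlocks.run B ω σ).coins = σ.coins ∧
    (stepBlocks.run B ω σ).time = σ.time + 1 + (N * N - N) * (7 + 7 * N) := by
  have hd : N ≤ N * N := Nat.le_mul_self N
  have key := run_loop_induction B ω (a := 6) (p := blockStep) (σ := σ)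
    (fun k τ => τ.reg 13 = q + N * N + k * N ∧
      (∀ i < k, ∀ β < N, τ.mem (q + N * N + (i * N + β)) =
        (if β = 0 then 0 else τ.mem (q + (i * N + (β - 1)))) -
          τ.mem (q + (i * N + (N - 1))) * τ.mem (3 + β)) ∧
      (∀ x, x ≠ 2 → x < q + N * N ∨ q + N * N + k * N ≤ x → τ.mem x = σ.mem x) ∧
      τ.coins = σ.coins ∧ τ.time = σ.time + 1 + k * (7 + 7 * N))
    ⟨by simp [BBState.tick, h13], by simp, fun _ _ _ => rfl, rfl, by simp [BBState.tick]⟩ (by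
      rintro k - τ hτ ⟨t13, tm, tm', tc, tt⟩
      have hr : (τ.tick 1).IsReady n N := isReady_of_eq h (fun x h3 h13 => hτ x fun hx => by
        have := (by decide : blockStep.KeepsConstants) x hx
        omega) fun x hx => tm' x (by omega) (by omega)
      obtain ⟨b1, b2, b3, b4, b5⟩ := run_blockStep B ω (τ.tick 1) (q := q + k * N) hr.r3 hr.r4 hr.r8
        hr.r9 hr.r10 hr.r12 hr.m0 (show τ.reg 13 = _ by rw [t13]; ring) hN (by omega) hd
      have hmm : (τ.tick 1).mem = τ.mem := rfl
      have hcc : (τ.tick 1).coins = τ.coins := rfl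
      have htt : (τ.tick 1).time = τ.time + 1 := rfl
      rw [hmm] at b2 b3
      rw [hcc, tc] at b4
      rw [htt, tt] at b5
      refine ⟨by rw [b1]; ring, fun i hi β hβ => ?_, fun x hx hx' => ?_, b4, by rw [b5]; ring⟩
      · rcases Nat.lt_succ_iff_lt_or_eq.1 hi with hi | rfl
        · have hik : (i + 1) * N ≤ k * N := Nat.mul_le_mul_right _ hi
          rw [add_mul, one_mul] at hik
          rw [b3 (q + N * N + (i * N + β)) (by omega) (by omega),
            b3 (q + (i * N + (N - 1))) (by omega) (by omega), b3 (3 + β) (by omega) (by omega),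
            tm i hi β hβ]
          split_ifs
          · rfl
          · rw [b3 _ (by omega) (by omega)]
        · have e1 : q + N * N + (i * N + β) = q + i * N + N * N + β := by ring
          rw [e1, b2 β hβ, b3 (q + (i * N + (N - 1))) (by omega) (by omega),
            b3 (3 + β) (by omega) (by omega)]
          simp only [add_assoc]
          split_ifs
          · rfl
          · rw [b3 _ (by omega) (by omega)]
      · rw [add_mul, one_mul] at hx'
        rw [b3 x hx (by omega), tm' x hx (by omega)])
  rw [h.r6] at key
  exact key

/-- `N` rows of an array of blocks: a random one, then the rows computed from it. -/
def rowGroup : BBProg := .seq (fillCells 4) stepBlocks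

theorem rowGroup_size (N : ℕ) : N * N + (N * N - N) * N = N * (N * N) := by
  have := Nat.le_mul_self N
  obtain ⟨x, hx⟩ := Nat.exists_eq_add_of_le this
  rw [hx, Nat.add_sub_cancel_left, mul_add, ← hx, hx]
  rw [mul_comm x N, ← hx]

theorem run_rowGroup (σ : BBState F) {q : ℕ} (h : σ.IsReady n N) (h13 : σ.reg 13 = q)
    (hN : 0 < N) (hq : 3 + N ≤ q) :
    (rowGroup.run B ω σ).reg 13 = q + N * (N * N) ∧
    (∀ c < N * N, (rowGroup.run B ω σ).mem (q + c) =
      (bitsVal ω (σ.coins + 2 * N * c) (2 * N) : F)) ∧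
    (∀ i < N * N - N, ∀ β < N, (rowGroup.run B ω σ).mem (q + N * N + (i * N + β)) =
      (if β = 0 then 0 else (rowGroup.run B ω σ).mem (q + (i * N + (β - 1)))) -
        (rowGroup.run B ω σ).mem (q + (i * N + (N - 1))) * (rowGroup.run B ω σ).mem (3 + β)) ∧
    (∀ x, x ≠ 2 → x < q ∨ q + N * (N * N) ≤ x → (rowGroup.run B ω σ).mem x = σ.mem x) ∧
    (rowGroup.run B ω σ).coins = σ.coins + 2 * N * (N * N) ∧
    (rowGroup.run B ω σ).time =
      σ.time + 2 + N * N * (10 * N + 4) + (N * N - N) * (7 + 7 * N) := by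
  obtain ⟨f1, f2, f3, f4, f5⟩ := run_fillCells B ω σ (a := 4) h.r4 h.r7 h.r9 h.m1 h13 (by omega)
  have hr : ((fillCells 4).run B ω σ).IsReady n N :=
    IsReady.run B ω (by decide) h fun x hx => f3 x (by omega)
  obtain ⟨s1, s2, s3, s4, s5⟩ := run_stepBlocks B ω _ hr f1 hN hq
  have hsize := rowGroup_size N
  rw [rowGroup, run_seq]
  refine ⟨by rw [s1]; omega, fun c hc => ?_, s2, fun x hx hx' => ?_, by rw [s4, f4], ?_⟩
  · rw [s3 _ (by omega) (by omega), f2 c hc]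
  · rw [s3 x hx (by omega), f3 x (by omega)]
  · rw [s5, f5]; ring

/-- As many groups of rows as register `5` says. -/
def rowGroups : BBProg := .loop 5 rowGroup

theorem run_rowGroups (σ : BBState F) (h : σ.IsReady n N) (h13 : σ.reg 13 = 3 + N)
    (hN : 0 < N) :
    (∀ g < n * N, ∀ c < N * N, (rowGroups.run B ω σ).mem (3 + N + (g * (N * (N * N)) + c)) =
      (bitsVal ω (σ.coins + 2 * N * (g * (N * N) + c)) (2 * N) : F)) ∧
    (∀ g < n * N, ∀ i < N * N - N, ∀ β < N,
      (rowGroups.run B ω σ).mem (3 + N + (g * (N * (N * N)) + (N * N + (i * N + β)))) =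
      (if β = 0 then 0 else
        (rowGroups.run B ω σ).mem (3 + N + (g * (N * (N * N)) + (i * N + (β - 1))))) -
        (rowGroups.run B ω σ).mem (3 + N + (g * (N * (N * N)) + (i * N + (N - 1)))) *
          (rowGroups.run B ω σ).mem (3 + β)) ∧
    (∀ x, x ≠ 2 → x < 3 + N → (rowGroups.run B ω σ).mem x = σ.mem x) ∧
    (rowGroups.run B ω σ).coins = σ.coins + 2 * N * (n * N * (N * N)) ∧
    (rowGroups.run B ω σ).time =
      σ.time + 1 + n * N * (3 + N * N * (10 * N + 4) + (N * N - N) * (7 + 7 * N)) := by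
  have hsize := rowGroup_size N
  have hd : N ≤ N * N := Nat.le_mul_self N
  have key := run_loop_induction B ω (a := 5) (p := rowGroup) (σ := σ)
    (fun k τ => τ.reg 13 = 3 + N + k * (N * (N * N)) ∧
      (∀ g < k, ∀ c < N * N, τ.mem (3 + N + (g * (N * (N * N)) + c)) =
        (bitsVal ω (σ.coins + 2 * N * (g * (N * N) + c)) (2 * N) : F)) ∧
      (∀ g < k, ∀ i < N * N - N, ∀ β < N,
        τ.mem (3 + N + (g * (N * (N * N)) + (N * N + (i * N + β)))) =
        (if β = 0 then 0 else τ.mem (3 + N + (g * (N * (N * N)) + (i * N + (β - 1))))) -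
        τ.mem (3 + N + (g * (N * (N * N)) + (i * N + (N - 1)))) * τ.mem (3 + β)) ∧
      (∀ x, x ≠ 2 → x < 3 + N → τ.mem x = σ.mem x) ∧
      τ.coins = σ.coins + 2 * N * (k * (N * N)) ∧
      τ.time = σ.time + 1 + k * (3 + N * N * (10 * N + 4) + (N * N - N) * (7 + 7 * N)))
    ⟨by simp [BBState.tick, h13], by simp, by simp, fun _ _ _ => rfl, by simp [BBState.tick],
      by simp [BBState.tick]⟩ (by
      rintro k - τ hτ ⟨t13, tm, ts, tm', tc, tt⟩
      have hr : (τ.tick 1).IsReady n N := isReady_of_eq h (fun x h3 h13 => hτ x fun hx => by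
        have := (by decide : rowGroup.KeepsConstants) x hx
        omega) fun x hx => tm' x (by omega) (by omega)
      obtain ⟨b1, b2, b3, b4, b5, b6⟩ := run_rowGroup B ω (τ.tick 1) hr t13 hN (by omega)
      have hmm : (τ.tick 1).mem = τ.mem := rfl
      have hcc : (τ.tick 1).coins = τ.coins := rfl
      have htt : (τ.tick 1).time = τ.time + 1 := rfl
      rw [hmm] at b4
      rw [hcc, tc] at b2 b5
      rw [htt, tt] at b6
      have hlow : ∀ g < k, ∀ c < N * (N * N),
          (rowGroup.run B ω (τ.tick 1)).mem (3 + N + (g * (N * (N * N)) + c)) =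
            τ.mem (3 + N + (g * (N * (N * N)) + c)) := fun g hg c hc => b4 _ (by omega) (by
        have : (g + 1) * (N * (N * N)) ≤ k * (N * (N * N)) := Nat.mul_le_mul_right _ hg
        rw [add_mul, one_mul] at this
        omega)
      have hblk : ∀ i < N * N - N, i * N + N ≤ (N * N - N) * N := fun i hi => by
        have : (i + 1) * N ≤ (N * N - N) * N := Nat.mul_le_mul_right _ hi
        rwa [add_mul, one_mul] at this
      refine ⟨by rw [b1]; ring, fun g hg c hc => ?_, fun g hg i hi β hβ => ?_, fun x hx hx' => ?_,
        by rw [b5]; ring, by rw [b6]; ring⟩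
      · rcases Nat.lt_succ_iff_lt_or_eq.1 hg with hg | rfl
        · rw [hlow g hg c (by omega), tm g hg c hc]
        · rw [← add_assoc, b2 c hc]
          congr 2
          ring
      · have hi' := hblk i hi
        rcases Nat.lt_succ_iff_lt_or_eq.1 hg with hg | rfl
        · rw [hlow g hg (N * N + (i * N + β)) (by omega),
            hlow g hg (i * N + (N - 1)) (by omega), b4 (3 + β) (by omega) (by omega),
            ts g hg i hi β hβ]
          split_ifs
          · rfl
          · rw [hlow g hg _ (by omega)]
        · have := b3 i hi β hβ
          simpa only [add_assoc] using this
      · rw [b4 x hx (by omega), tm' x hx hx'])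
  rw [h.r5] at key
  exact key.2

/-- Set register `2` to `1` if one of the cells from `[13]` on is not zero; their number is the
square of the content of register `4`. -/
def checkCells : BBProg :=
  .loop 4 (.loop 4 (.seq (.ifFZero 13 (.zero 17) (.succ 2 8)) (.succ 13 13)))

theorem run_checkCell (σ : BBState F) (h8 : σ.reg 8 = 0) :
    let τ := run B ω (.seq (.ifFZero 13 (.zero 17) (.succ 2 8)) (.succ 13 13)) σ
    τ.reg 13 = σ.reg 13 + 1 ∧ τ.mem = σ.mem ∧ τ.coins = σ.coins ∧ τ.time = σ.time + 3 ∧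
      (τ.reg 2 = 0 ↔ σ.reg 2 = 0 ∧ σ.mem (σ.reg 13) = 0) := by
  by_cases h : σ.mem (σ.reg 13) = 0 <;>
    simp [run, BBState.setReg, BBState.tick, BBState.get, h, h8]

theorem run_checkRow (σ : BBState F) {d : ℕ} (h4 : σ.reg 4 = d) (h8 : σ.reg 8 = 0) :
    let τ := run B ω (.loop 4 (.seq (.ifFZero 13 (.zero 17) (.succ 2 8)) (.succ 13 13))) σ
    τ.reg 13 = σ.reg 13 + d ∧ τ.mem = σ.mem ∧ τ.coins = σ.coins ∧
      τ.time = σ.time + 1 + d * 4 ∧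
      (τ.reg 2 = 0 ↔ σ.reg 2 = 0 ∧ ∀ j < d, σ.mem (σ.reg 13 + j) = 0) := by
  have key := run_loop_induction B ω (a := 4)
    (p := .seq (.ifFZero 13 (.zero 17) (.succ 2 8)) (.succ 13 13)) (σ := σ)
    (fun k τ => τ.reg 13 = σ.reg 13 + k ∧ τ.mem = σ.mem ∧ τ.coins = σ.coins ∧
      τ.time = σ.time + 1 + k * 4 ∧
      (τ.reg 2 = 0 ↔ σ.reg 2 = 0 ∧ ∀ j < k, σ.mem (σ.reg 13 + j) = 0))
    ⟨rfl, rfl, rfl, by simp [BBState.tick], by simp [BBState.tick]⟩ (by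
      rintro k - τ hτ ⟨t1, t2, t3, t4, t5⟩
      obtain ⟨c1, c2, c3, c4, c5⟩ := run_checkCell B ω (τ.tick 1) ((hτ 8 (by decide)).trans h8)
      simp only [BBState.tick] at c1 c2 c3 c4 c5 ⊢
      refine ⟨by rw [c1, t1]; ring, c2.trans t2, c3.trans t3, by rw [c4, t4]; ring, ?_⟩
      rw [c5, t5, t1, t2, Nat.forall_lt_succ_right, and_assoc])
  rw [h4] at key
  exact key

theorem run_checkCells (σ : BBState F) {d : ℕ} (h4 : σ.reg 4 = d) (h8 : σ.reg 8 = 0) :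
    (checkCells.run B ω σ).mem = σ.mem ∧ (checkCells.run B ω σ).coins = σ.coins ∧
      (checkCells.run B ω σ).time = σ.time + 1 + d * (2 + d * 4) ∧
      ((checkCells.run B ω σ).reg 2 = 0 ↔
        σ.reg 2 = 0 ∧ ∀ i < d, ∀ j < d, σ.mem (σ.reg 13 + (i * d + j)) = 0) := by
  have key := run_loop_induction B ω (a := 4)
    (p := .loop 4 (.seq (.ifFZero 13 (.zero 17) (.succ 2 8)) (.succ 13 13))) (σ := σ)
    (fun k τ => τ.reg 13 = σ.reg 13 + k * d ∧ τ.mem = σ.mem ∧ τ.coins = σ.coins ∧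
      τ.time = σ.time + 1 + k * (2 + d * 4) ∧
      (τ.reg 2 = 0 ↔ σ.reg 2 = 0 ∧ ∀ i < k, ∀ j < d, σ.mem (σ.reg 13 + (i * d + j)) = 0))
    ⟨by simp [BBState.tick], rfl, rfl, by simp [BBState.tick], by simp [BBState.tick]⟩ (by
      rintro k - τ hτ ⟨t1, t2, t3, t4, t5⟩
      obtain ⟨c1, c2, c3, c4, c5⟩ := run_checkRow B ω (τ.tick 1) ((hτ 4 (by decide)).trans h4)
        ((hτ 8 (by decide)).trans h8)
      simp only [BBState.tick] at c1 c2 c3 c4 c5 ⊢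
      refine ⟨by rw [c1, t1]; ring, c2.trans t2, c3.trans t3, by rw [c4, t4]; ring, ?_⟩
      rw [c5, t5, t1, t2, Nat.forall_lt_succ_right, and_assoc]
      simp only [add_assoc])
  rw [h4] at key
  exact key.2

/-- Query random block matrices and record in register `2` whether the answer is nonzero. -/
def round : BBProg :=
  .seq (.add 13 10 8) <| .seq (fillCells 3) <| .seq rowGroups <| .seq (.query 4 11 11) <|
    .seq (.add 13 11 8) checkCells

/-- The time one round takes. -/
def roundTime (n N : ℕ) : ℕ :=
  6 + N * (10 * N + 4) + n * N * (3 + N * N * (10 * N + 4) + (N * N - N) * (7 + 7 * N)) +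
    (n + 1) * (N * N) ^ 2 + N * N * (2 + N * N * 4)

theorem run_round (σ : BBState F) (h : σ.IsReady n N) (hN : 0 < N) :
    (round.run B ω σ).IsReady n N ∧
    (round.run B ω σ).coins = σ.coins + roundCoins n N ∧
    (round.run B ω σ).time = σ.time + roundTime n N ∧
    ∃ e : ℕ → ℕ → F, IsBlockArray n N (drawn N fun i => ω (σ.coins + i)) e ∧
      ((round.run B ω σ).reg 2 = 0 ↔
        σ.reg 2 = 0 ∧ B (N * N) (arrayMatrices n N e) = 0) := by
  have hd : N ≤ N * N := Nat.le_mul_self N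
  rw [round]
  iterate 5 rw [run_seq]
  set σ₁ := (BBProg.add 13 10 8).run B ω σ with hσ₁
  have h1 : σ₁.IsReady n N := IsReady.run B ω (by decide) h fun x _ => rfl
  have h1p : σ₁.reg 13 = 3 := by simp [hσ₁, run, BBState.setReg, h.r10, h.r8]
  have h1a : σ₁.reg 2 = σ.reg 2 := run_reg_of_notMem_writes B ω _ _ _ (by decide)
  have h1c : σ₁.coins = σ.coins := rfl
  have h1t : σ₁.time = σ.time + 1 := rfl
  clear_value σ₁
  obtain ⟨f1, f2, f3, f4, f5⟩ := run_fillCells B ω σ₁ (a := 3) h1.r3 h1.r7 h1.r9 h1.m1 h1p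
    (by omega)
  have f6 : ((fillCells 3).run B ω σ₁).reg 2 = σ₁.reg 2 :=
    run_reg_of_notMem_writes B ω _ _ _ (by decide)
  have h2 : ((fillCells 3).run B ω σ₁).IsReady n N :=
    IsReady.run B ω (by decide) h1 fun x hx => f3 x (by omega)
  set σ₂ := (fillCells 3).run B ω σ₁
  clear_value σ₂
  obtain ⟨g1, g2, g3, g4, g5⟩ := run_rowGroups B ω σ₂ h2 f1 hN
  have g6 : (rowGroups.run B ω σ₂).reg 2 = σ₂.reg 2 :=
    run_reg_of_notMem_writes B ω _ _ _ (by decide)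
  have h3 : (rowGroups.run B ω σ₂).IsReady n N :=
    IsReady.run B ω (by decide) h2 fun x hx => g3 x (by omega) (by omega)
  set σ₃ := rowGroups.run B ω σ₂
  clear_value σ₃
  set e : ℕ → ℕ → F := fun ρ c => σ₃.mem (3 + N + (ρ * (N * N) + c)) with he
  have hq : (BBProg.query 4 11 11).run B ω σ₃ =
      (σ₃.writeMatrix (N * N) (3 + N) (B (N * N) (arrayMatrices n N e))).tick
        (1 + (n + 1) * (N * N) ^ 2) := by
    have hread : σ₃.readMatrices n (N * N) (3 + N) = arrayMatrices n N e := rfl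
    rw [run, h3.r4, h3.r11, hread]
  rw [hq]
  set M := B (N * N) (arrayMatrices n N e)
  set σ₄ := (σ₃.writeMatrix (N * N) (3 + N) M).tick (1 + (n + 1) * (N * N) ^ 2) with hσ₄
  have h4m : ∀ x, x < 3 + N → σ₄.mem x = σ₃.mem x := fun x hx =>
    dif_neg fun h => by omega
  have h4 : σ₄.IsReady n N := isReady_of_eq h3 (fun x _ _ => rfl) fun x hx => h4m x (by omega)
  have h4z : (∀ i < N * N, ∀ j < N * N, σ₄.mem (3 + N + (i * (N * N) + j)) = 0) ↔ M = 0 := by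
    have hval : ∀ (i j : Fin (N * N)), σ₄.mem (3 + N + (i * (N * N) + j)) = M i j := by
      intro i j
      have hlt : (i : ℕ) * (N * N) + j < N * N * (N * N) :=
        calc (i : ℕ) * (N * N) + j < i * (N * N) + N * N := Nat.add_lt_add_left j.2 _
          _ = (i + 1) * (N * N) := by ring
          _ ≤ _ := Nat.mul_le_mul_right _ i.2
      have hpos : 0 < N * N := by positivity
      have hc : 3 + N ≤ 3 + N + (i * (N * N) + j) ∧
          3 + N + (i * (N * N) + j) - (3 + N) < N * N * (N * N) := by
        rw [Nat.add_sub_cancel_left]; exact ⟨Nat.le_add_right _ _, hlt⟩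
      have : σ₄.mem (3 + N + (i * (N * N) + j)) = _ := dif_pos hc
      rw [this]
      congr 1
      · ext
        simp only [Nat.add_sub_cancel_left]
        rw [mul_comm, Nat.mul_add_div hpos, Nat.div_eq_of_lt j.2, add_zero]
      · ext
        simp only [Nat.add_sub_cancel_left]
        rw [mul_comm, Nat.mul_add_mod, Nat.mod_eq_of_lt j.2]
    constructor
    · intro h
      ext i j
      rw [← hval, h i i.2 j j.2]
      rfl
    · intro h i hi j hj
      rw [hval ⟨i, hi⟩ ⟨j, hj⟩, h]
      rfl
  have h4c : σ₄.coins = σ₃.coins := rfl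
  have h4t : σ₄.time = σ₃.time + (1 + (n + 1) * (N * N) ^ 2) := rfl
  have h4a : σ₄.reg 2 = σ₃.reg 2 := rfl
  clear_value σ₄
  set σ₅ := (BBProg.add 13 11 8).run B ω σ₄ with hσ₅
  have h5 : σ₅.IsReady n N := IsReady.run B ω (by decide) h4 fun x _ => rfl
  have h5p : σ₅.reg 13 = 3 + N := by simp [hσ₅, run, BBState.setReg, h4.r11, h4.r8]
  have h5a : σ₅.reg 2 = σ₄.reg 2 := run_reg_of_notMem_writes B ω _ _ _ (by decide)
  have h5m : σ₅.mem = σ₄.mem := rfl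
  have h5c : σ₅.coins = σ₄.coins := rfl
  have h5t : σ₅.time = σ₄.time + 1 := rfl
  clear_value σ₅
  obtain ⟨c1, c2, c3, c4⟩ := run_checkCells B ω σ₅ h5.r4 h5.r8
  refine ⟨IsReady.run B ω (by decide) h5 fun x _ => by rw [c1], ?_, ?_, e, ⟨?_, ?_⟩, ?_⟩
  · rw [c2, h5c, h4c, g4, f4, h1c, roundCoins]; ring
  · rw [c3, h5t, h4t, g5, f5, h1t, roundTime]; ring
  · intro g hg c hc
    have := g1 g hg c hc
    rw [he]
    simp only
    rw [mul_assoc g N, this, drawn, bitsVal_shift, f4, h1c]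
    congr 2
    ring
  · intro g hg α hα b hb β hβ
    have hi : α * N + b < N * N - N := by
      have : (α + 2) * N ≤ N * N := Nat.mul_le_mul_right _ hα
      rw [add_mul] at this
      omega
    have := g2 g hg _ hi β hβ
    rw [g3 (3 + β) (by omega) (by omega), f2 β hβ] at this
    have e1 : 3 + N + (g * (N * (N * N)) + (N * N + ((α * N + b) * N + β))) =
        3 + N + ((g * N + (α + 1)) * (N * N) + (b * N + β)) := by ring
    have e2 : ∀ x, 3 + N + (g * (N * (N * N)) + ((α * N + b) * N + x)) =
        3 + N + ((g * N + α) * (N * N) + (b * N + x)) := fun x => by ring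
    rw [e1, e2, e2] at this
    rw [he]
    simp only
    rw [this, drawn, bitsVal_shift, h1c]
  · rw [c4, h5a, h4a, g6, f6, h1a, h5p, h5m, h4z]

end BBProg

end Machine

section Machine

namespace BBProg

variable {F : Type u} [Field F] {n N : ℕ}
  (B : (d : ℕ) → (Fin n → Matrix (Fin d) (Fin d) F) → Matrix (Fin d) (Fin d) F) (ω : ℕ → Bool)

theorem run_loop_add (σ : BBState F) {a b c : ℕ} (hb : b ≠ c) :
    ((BBProg.loop a (.add b b c)).run B ω σ).reg b = σ.reg b + σ.reg a * σ.reg c ∧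
    ((BBProg.loop a (.add b b c)).run B ω σ).mem = σ.mem ∧
    ((BBProg.loop a (.add b b c)).run B ω σ).coins = σ.coins ∧
    ((BBProg.loop a (.add b b c)).run B ω σ).time = σ.time + 1 + σ.reg a * 2 :=
  run_loop_induction B ω (fun k τ => τ.reg b = σ.reg b + k * σ.reg c ∧ τ.mem = σ.mem ∧
    τ.coins = σ.coins ∧ τ.time = σ.time + 1 + k * 2)
    ⟨by simp [BBState.tick], rfl, rfl, by simp [BBState.tick]⟩ (by
      rintro k - τ hτ ⟨t1, t2, t3, t4⟩
      have hc : τ.reg c = σ.reg c := hτ c (by simpa [writes] using hb.symm)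
      refine ⟨?_, t2, t3, ?_⟩
      · simp [run, BBState.setReg, BBState.tick, t1, hc]; ring
      · simp [run, BBState.setReg, BBState.tick, t4]; ring)

/-- The part of the initialization without loops. -/
def setupSmall : BBProg :=
  .seq (.zero 8) <| .seq (.succ 9 8) <| .seq (.succ 3 8) <| .seq (.add 3 3 3) <|
  .seq (.add 3 3 3) <| .seq (.add 3 3 3) <| .seq (.add 3 3 3) <| .seq (.add 3 3 1) <|
  .seq (.add 7 3 3) <| .seq (.succ 12 9) <| .seq (.succ 10 12) <| .seq (.add 11 10 3) (.fone 9)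

/-- Compute the parameters of the rounds. -/
def setup : BBProg :=
  .seq setupSmall <| .seq (.loop 3 (.add 4 4 3)) <| .seq (.loop 3 (.add 5 5 0)) (.sub 6 4 3)

theorem run_setup (s : ℕ) :
    (setup.run B ω (BBState.init F n s)).IsReady n (s + 16) ∧
    (setup.run B ω (BBState.init F n s)).reg 2 = 0 ∧
    (setup.run B ω (BBState.init F n s)).coins = 0 ∧
    (setup.run B ω (BBState.init F n s)).time = 16 + 4 * (s + 16) := by
  rw [setup]
  iterate 3 rw [run_seq]
  set σ := setupSmall.run B ω (BBState.init F n s) with hσ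
  have e0 : σ.reg 0 = n := by simp [hσ, setupSmall, run, BBState.setReg, BBState.setMem, BBState.init]
  have e2 : σ.reg 2 = 0 := by simp [hσ, setupSmall, run, BBState.setReg, BBState.setMem, BBState.init]
  have e3 : σ.reg 3 = s + 16 := by
    simp [hσ, setupSmall, run, BBState.setReg, BBState.setMem, BBState.init]; omega
  have e4 : σ.reg 4 = 0 := by simp [hσ, setupSmall, run, BBState.setReg, BBState.setMem, BBState.init]
  have e5 : σ.reg 5 = 0 := by simp [hσ, setupSmall, run, BBState.setReg, BBState.setMem, BBState.init]
  have e7 : σ.reg 7 = 2 * (s + 16) := by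
    simp [hσ, setupSmall, run, BBState.setReg, BBState.setMem, BBState.init]; omega
  have e8 : σ.reg 8 = 0 := by simp [hσ, setupSmall, run, BBState.setReg, BBState.setMem, BBState.init]
  have e9 : σ.reg 9 = 1 := by simp [hσ, setupSmall, run, BBState.setReg, BBState.setMem, BBState.init]
  have e10 : σ.reg 10 = 3 := by
    simp [hσ, setupSmall, run, BBState.setReg, BBState.setMem, BBState.init]
  have e11 : σ.reg 11 = 3 + (s + 16) := by
    simp [hσ, setupSmall, run, BBState.setReg, BBState.setMem, BBState.init]; omega
  have e12 : σ.reg 12 = 2 := by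
    simp [hσ, setupSmall, run, BBState.setReg, BBState.setMem, BBState.init]
  have m0 : σ.mem 0 = 0 := by
    simp [hσ, setupSmall, run, BBState.setReg, BBState.setMem, BBState.init]
  have m1 : σ.mem 1 = 1 := by
    simp [hσ, setupSmall, run, BBState.setReg, BBState.setMem, BBState.init]
  have ec : σ.coins = 0 := rfl
  have et : σ.time = 13 := rfl
  clear_value σ
  obtain ⟨a1, a2, a3, a4⟩ := run_loop_add B ω σ (a := 3) (b := 4) (c := 3) (by decide)
  have af := fun x hx => run_reg_of_notMem_writes B ω (.loop 3 (.add 4 4 3)) σ x hx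
  set σ₁ := (BBProg.loop 3 (.add 4 4 3)).run B ω σ
  clear_value σ₁
  obtain ⟨b1, b2, b3, b4⟩ := run_loop_add B ω σ₁ (a := 3) (b := 5) (c := 0) (by decide)
  have bf := fun x hx => run_reg_of_notMem_writes B ω (.loop 3 (.add 5 5 0)) σ₁ x hx
  set σ₂ := (BBProg.loop 3 (.add 5 5 0)).run B ω σ₁
  clear_value σ₂
  have cf := fun x hx => run_reg_of_notMem_writes B ω (.sub 6 4 3) σ₂ x hx
  have keep : ∀ x, x ∉ [4, 5, 6] → ((BBProg.sub 6 4 3).run B ω σ₂).reg x = σ.reg x := by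
    intro x hx
    simp only [List.mem_cons, List.not_mem_nil, or_false, not_or] at hx
    rw [cf x (by simpa [writes] using hx.2.2), bf x (by simpa [writes] using hx.2.1),
      af x (by simpa [writes] using hx.1)]
  have k4 : σ₂.reg 4 = (s + 16) * (s + 16) := by
    rw [bf 4 (by decide), a1, e4, e3, zero_add]
  have k3 : σ₂.reg 3 = s + 16 := by rw [bf 3 (by decide), af 3 (by decide), e3]
  have k5 : σ₂.reg 5 = n * (s + 16) := by
    rw [b1, af 5 (by decide), af 3 (by decide), af 0 (by decide), e5, e3, e0]; ring
  refine ⟨⟨?_, ?_, ?_, ?_, ?_, ?_, ?_, ?_, ?_, ?_, ?_, ?_⟩, ?_, ?_, ?_⟩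
  · rw [keep 3 (by decide), e3]
  · rw [cf 4 (by decide), k4]
  · rw [cf 5 (by decide), k5]
  · simp [run, BBState.setReg, k4, k3]
  · rw [keep 7 (by decide), e7]
  · rw [keep 8 (by decide), e8]
  · rw [keep 9 (by decide), e9]
  · rw [keep 10 (by decide), e10]
  · rw [keep 11 (by decide), e11]
  · rw [keep 12 (by decide), e12]
  · exact (congrFun (b2.trans a2) 0).trans m0
  · exact (congrFun (b2.trans a2) 1).trans m1
  · rw [keep 2 (by decide), e2]
  · exact (b3.trans a3).trans ec
  · rw [run]
    simp only [BBState.setReg]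
    rw [b4, a4, et, af 3 (by decide), e3]
    ring

/-- The identity test for homogeneous `ΣΠ*Σ` circuits. -/
def identityTest : BBProg := .seq setup (.loop 4 round)

theorem run_identityTest (s : ℕ) :
    (identityTest.run B ω (BBState.init F n s)).time =
      17 + 4 * (s + 16) + (s + 16) * (s + 16) * (1 + roundTime n (s + 16)) ∧
    ((∀ d M, B d M = 0) → (identityTest.run B ω (BBState.init F n s)).reg 2 = 0) ∧
    ((identityTest.run B ω (BBState.init F n s)).reg 2 = 0 → ∀ r < (s + 16) * (s + 16),
      ¬ RoundDetects (s + 16) B fun i => ω (r * roundCoins n (s + 16) + i)) := by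
  obtain ⟨hr, h2, hc, ht⟩ := run_setup B ω s
  rw [identityTest, run_seq]
  set σ := setup.run B ω (BBState.init F n s)
  clear_value σ
  have key := run_loop_induction B ω (a := 4) (p := round) (σ := σ)
    (fun k τ => τ.IsReady n (s + 16) ∧ τ.coins = k * roundCoins n (s + 16) ∧
      τ.time = 17 + 4 * (s + 16) + k * (1 + roundTime n (s + 16)) ∧
      ((∀ d M, B d M = 0) → τ.reg 2 = 0) ∧
      (τ.reg 2 = 0 → ∀ r < k,
        ¬ RoundDetects (s + 16) B fun i => ω (r * roundCoins n (s + 16) + i)))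
    ⟨isReady_of_eq hr (fun _ _ _ => rfl) fun _ _ => rfl, by simp [BBState.tick, hc],
      by simp only [BBState.tick, ht]; ring, fun _ => h2, by simp⟩ (by
      rintro k - τ - ⟨t1, t2, t3, t4, t5⟩
      have t1' : (τ.tick 1).IsReady n (s + 16) := isReady_of_eq t1 (fun _ _ _ => rfl) fun _ _ => rfl
      obtain ⟨c1, c2, c3, e, he, c4⟩ := run_round B ω (τ.tick 1) t1' (by omega)
      simp only [BBState.tick] at c2 c3 c4 he
      refine ⟨c1, by rw [BBState.tick, c2, t2]; ring, by rw [BBState.tick, c3, t3]; ring,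
        fun h => c4.2 ⟨t4 h, h _ _⟩, fun h r hr => ?_⟩
      obtain ⟨h1, h2⟩ := c4.1 h
      rcases Nat.lt_succ_iff_lt_or_eq.1 hr with hr | rfl
      · exact t5 h1 r hr
      · rw [t2] at he
        exact fun hd => hd e he h2)
  rw [hr.r4] at key
  exact ⟨key.2.2.1, key.2.2.2⟩

end BBProg

end Machine

section Bounds

theorem time_bound (n s : ℕ) :
    17 + 4 * (s + 16) + (s + 16) * (s + 16) * (1 + BBProg.roundTime n (s + 16)) ≤
      (n + s + 2) ^ 36 := by
  obtain ⟨Y, hY⟩ : ∃ Y, Y = 8 * (n + s + 2) := ⟨_, rfl⟩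
  have hY4 : Y ≤ (n + s + 2) ^ 4 := by
    have : 2 ^ 3 ≤ (n + s + 2) ^ 3 := Nat.pow_le_pow_left (by omega) 3
    rw [hY, pow_succ (n + s + 2) 3]
    exact Nat.mul_le_mul_right _ this
  have h16 : 16 ≤ Y := by omega
  have hN : s + 16 ≤ Y := by omega
  have hn : n + 1 ≤ Y := by omega
  have hn' : n ≤ Y := by omega
  generalize s + 16 = N at hN
  have hround : BBProg.roundTime n N ≤ 6 + Y * (10 * Y + 4) +
      Y * Y * (3 + Y * Y * (10 * Y + 4) + (Y * Y) * (7 + 7 * Y)) +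
        Y * (Y * Y) ^ 2 + Y * Y * (2 + Y * Y * 4) := by
    rw [BBProg.roundTime]
    gcongr
    exact (Nat.sub_le _ _).trans (Nat.mul_le_mul hN hN)
  have hp : ∀ i j, i ≤ j → Y ^ i ≤ Y ^ j := fun i j h => Nat.pow_le_pow_right (by omega) h
  have hround' : BBProg.roundTime n N ≤ 58 * Y ^ 5 := by
    refine hround.trans ?_
    have h0 := hp 0 5 (by norm_num)
    have h1 := hp 1 5 (by norm_num)
    have h2 := hp 2 5 (by norm_num)
    have h3 := hp 3 5 (by norm_num)
    have h4 := hp 4 5 (by norm_num)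
    ring_nf at *
    omega
  calc 17 + 4 * N + N * N * (1 + BBProg.roundTime n N)
      ≤ 17 + 4 * Y + Y * Y * (1 + 58 * Y ^ 5) := by gcongr
    _ ≤ 16 * 16 * Y ^ 7 := by
        have h0 := hp 0 7 (by norm_num)
        have h1 := hp 1 7 (by norm_num)
        have h2 := hp 2 7 (by norm_num)
        ring_nf at *
        omega
    _ ≤ Y * Y * Y ^ 7 := by gcongr
    _ = Y ^ 9 := by ring
    _ ≤ ((n + s + 2) ^ 4) ^ 9 := Nat.pow_le_pow_left hY4 9
    _ = (n + s + 2) ^ 36 := by rw [← pow_mul]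

theorem roundCoins_le_roundTime (n N : ℕ) : roundCoins n N ≤ BBProg.roundTime n N := by
  rw [roundCoins, BBProg.roundTime]
  have h1 : 2 * N * N ≤ N * (10 * N + 4) := by nlinarith
  have h2 : 2 * N * (n * N * (N * N)) ≤
      n * N * (3 + N * N * (10 * N + 4) + (N * N - N) * (7 + 7 * N)) := by
    calc 2 * N * (n * N * (N * N)) = n * N * (N * N * (2 * N)) := by ring
      _ ≤ _ := by
        refine Nat.mul_le_mul_left _ ?_
        have : N * N * (2 * N) ≤ N * N * (10 * N + 4) := Nat.mul_le_mul_left _ (by omega)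
        omega
  rw [mul_add]
  omega

theorem pow_mul_add_le (x k : ℕ) : x ^ k * (x + k) ≤ (x + 1) ^ k * x := by
  induction k with
  | zero => simp
  | succ k ih =>
    calc x ^ (k + 1) * (x + (k + 1)) ≤ x ^ k * (x + k) * (x + 1) := by
          rw [pow_succ, mul_assoc, mul_assoc]
          refine Nat.mul_le_mul_left _ ?_
          nlinarith
      _ ≤ (x + 1) ^ k * x * (x + 1) := Nat.mul_le_mul_right _ ih
      _ = (x + 1) ^ (k + 1) * x := by ring

theorem three_mul_pow_le {q R : ℕ} (hq : 2 ≤ q) (hR : 2 * q ≤ R) :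
    3 * (q - 1) ^ R ≤ q ^ R := by
  obtain ⟨x, rfl⟩ : ∃ x, q = x + 1 := ⟨q - 1, by omega⟩
  obtain ⟨r, rfl⟩ := Nat.exists_eq_add_of_le hR
  rw [Nat.add_sub_cancel]
  have h1 : 2 * x ^ (x + 1) ≤ (x + 1) ^ (x + 1) := by
    refine Nat.le_of_mul_le_mul_right (c := x) ?_ (by omega)
    refine le_trans ?_ (pow_mul_add_le x (x + 1))
    calc 2 * x ^ (x + 1) * x = x ^ (x + 1) * (2 * x) := by ring
      _ ≤ _ := Nat.mul_le_mul_left _ (by omega)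
  calc 3 * x ^ (2 * (x + 1) + r) ≤ 4 * x ^ (2 * (x + 1) + r) := Nat.mul_le_mul_right _ (by omega)
    _ = (2 * x ^ (x + 1)) * (2 * x ^ (x + 1)) * x ^ r := by ring
    _ ≤ ((x + 1) ^ (x + 1)) * ((x + 1) ^ (x + 1)) * (x + 1) ^ r :=
        Nat.mul_le_mul (Nat.mul_le_mul h1 h1) (Nat.pow_le_pow_left (by omega) r)
    _ = (x + 1) ^ (2 * (x + 1) + r) := by ring

end Bounds

theorem corollary3 :
    ∃ (P : BBProg) (c : ℕ), ∀ (F : Type u) [Field F] (n s : ℕ) (C : NCCircuit F n),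
      C.IsHomogeneousSigmaPiStarSigma → C.size ≤ s →
        (∀ ω : ℕ → Bool,
          (P.run C.blackBox ω (BBState.init F n s)).time ≤ (n + s + 2) ^ c) ∧
        (C.poly = 0 → ∀ ω : ℕ → Bool,
          (P.run C.blackBox ω (BBState.init F n s)).AnswersZero) ∧
        (C.poly ≠ 0 →
          2 / 3 ≤ coinProb ((n + s + 2) ^ c) fun ω =>
            ¬ (P.run C.blackBox ω (BBState.init F n s)).AnswersZero) := by
  classical
  refine ⟨BBProg.identityTest, 36, fun F _ n s C hC hs => ⟨fun ω => ?_, fun h0 ω => ?_, fun h0 => ?_⟩⟩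
  · rw [(BBProg.run_identityTest C.blackBox ω s).1]
    exact time_bound n s
  · exact (BBProg.run_identityTest C.blackBox ω s).2.1 fun d M =>
      C.blackBox_eq_zero_of_poly_eq_zero h0 d M
  · set N := s + 16 with hN
    set T := (n + s + 2) ^ 36 with hT
    have hcoins : N * N * roundCoins n N ≤ T := by
      refine le_trans ?_ (time_bound n s)
      rw [← hN]
      exact (Nat.mul_le_mul_left (N * N) ((roundCoins_le_roundTime n N).trans
        (Nat.le_add_left _ 1))).trans (Nat.le_add_left _ _)
    clear_value T
    have hN8 : 2 * (8 * N) ≤ N * N := by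
      rw [← mul_assoc]
      exact Nat.mul_le_mul_right _ (by omega)
    have h2 := fun ω => (BBProg.run_identityTest C.blackBox ω s).2.2
    rw [← hN] at h2
    clear_value N
    have hmiss := card_all_miss_le (roundCoins n N) (N * N) T (8 * N) hcoins
      (RoundDetects N C.blackBox) (RoundDetects.congr C.blackBox)
      (card_roundDetects hC h0 (by omega) (by omega))
    set miss := Finset.univ.filter fun w : Fin T → Bool =>
      ∀ r < N * N, ¬ RoundDetects N C.blackBox fun i => extendBits w (r * roundCoins n N + i)
      with hmissdef
    have hthree : 3 * (8 * N - 1) ^ (N * N) ≤ (8 * N) ^ (N * N) :=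
      three_mul_pow_le (by omega) hN8
    have h3 : 3 * miss.card ≤ 2 ^ T := by
      have hpos : 0 < (8 * N) ^ (N * N) := Nat.pow_pos (by omega)
      refine le_of_mul_le_mul_left ?_ hpos
      calc (8 * N) ^ (N * N) * (3 * miss.card) = 3 * ((8 * N) ^ (N * N) * miss.card) := by ring
        _ ≤ 3 * ((8 * N - 1) ^ (N * N) * 2 ^ T) := Nat.mul_le_mul_left 3 hmiss
        _ = 3 * (8 * N - 1) ^ (N * N) * 2 ^ T := by ring
        _ ≤ (8 * N) ^ (N * N) * 2 ^ T := Nat.mul_le_mul_right _ hthree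
    rw [coinProb]
    set hit := Finset.univ.filter fun w : Fin T → Bool =>
      ¬ (BBProg.identityTest.run C.blackBox (fun i => if h : i < T then w ⟨i, h⟩ else false)
        (BBState.init F n s)).AnswersZero with hhit
    have hcompl : hitᶜ ⊆ miss := by
      intro w hw
      simp only [hhit, Finset.mem_compl, Finset.mem_filter, Finset.mem_univ, true_and,
        not_not] at hw
      simp only [hmissdef, Finset.mem_filter, Finset.mem_univ, true_and]
      exact h2 (extendBits w) hw
    have h4 := Finset.card_le_card hcompl
    rw [Finset.card_compl, Fintype.card_fun, Fintype.card_fin, Fintype.card_bool] at h4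
    have h5 : 2 * 2 ^ T ≤ 3 * hit.card := by omega
    have h6 : (2 * 2 ^ T : ℚ) ≤ 3 * hit.card := by exact_mod_cast h5
    refine le_of_le_of_eq (b := (hit.card : ℚ) / 2 ^ T) ?_ (by rw [hhit]; congr)
    rw [div_le_div_iff₀ (by norm_num) (by positivity)]
    linarith
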